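/- Let $\mathscr K$ be a complex Hilbert space and let $A$ be the generator of a strongly continuous semigroup $(\mathrm e^{tA})_{t\ge 0}$ on $\mathscr K$. Let $\mathsf X$ and $\mathsf Y$ be complex normed vector spaces, and let $T_{\mathsf X}\colon \mathsf X\to\mathscr K$ and $T_{\mathsf Y}\colon \mathscr K\to\mathsf Y$ be bounded linear operators. Write $\rho(A)$ for the resolvent set of $A$, $\mathbb C_+=\{\lambda\in\mathbb C:\operatorname{Re}\lambda>0\}$, $\mathbb D=\{\lambda\in\mathbb C:|\lambda|<1\}$, $\mathbb D_+=\mathbb D\cap\mathbb C_+$, and $\langle t\rangle=\sqrt{1+t^2}$. Suppose that the following two assumptions hold. (i) There exists $\tau_0\ge 1$ such that $\overline{\mathbb C_+}\setminus \mathrm i(-\tau_0,\tau_0)\subset\rho(A)$ and $$\sup_{\lambda\in\overline{\mathbb C_+\setminus\tau_0\mathbb D}}\|(A-\lambda)^{-1}\|_{\mathcal B(\mathscr K)}<\infty .$$ (ii) With this $\tau_0$, there exist $m\in\mathbb N_0=\{0,1,2,\dots\}$, $\kappa\in[0,1)$ and $C_0>0$ such that for all $\lambda\in\tau_0\mathbb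 D_+$ and all $j\in\{m,m+1,m+2\}$ if $\kappa=0$, respectively all $j\in\{m,m+1\}$ if $\kappa\ne 0$, we have $$\|T_{\mathsf Y}(A-\lambda)^{-1-j}T_{\mathsf X}\|_{\mathcal B(\mathsf X,\mathsf Y)}\le C_0|\lambda|^{m-\kappa-j}.$$ Then there exists $C>0$ such that for all $t\ge 0$ $$\|T_{\mathsf Y}\,\mathrm e^{tA}\,T_{\mathsf X}\|_{\mathcal B(\mathsf X,\mathsf Y)}\le C\,\langle t\rangle^{-m-1+\kappa}.$$ -/

import Mathlib

open Filter Topology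

/-- A strongly continuous semigroup of bounded operators on `E`, indexed by the times `t ≥ 0`.
(The values of `toFun` at negative times are irrelevant and never used.) -/
structure C0Semigroup (E : Type*) [NormedAddCommGroup E] [NormedSpace ℂ E] where
  toFun : ℝ → E →L[ℂ] E
  map_zero : toFun 0 = 1
  map_add : ∀ s t : ℝ, 0 ≤ s → 0 ≤ t → toFun (s + t) = toFun s ∘L toFun t
  continuousOn_orbit : ∀ x : E, ContinuousOn (fun t : ℝ => toFun t x) (Set.Ici 0)

namespace C0Semigroup

variable {E : Type*} [NormedAddCommGroup E] [NormedSpace ℂ E]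

instance : CoeFun (C0Semigroup E) (fun _ => ℝ → E →L[ℂ] E) := ⟨toFun⟩

/-- `y` is the derivative at time `0` from the right of the orbit of `x`. -/
def HasGenerator (S : C0Semigroup E) (x y : E) : Prop :=
  Tendsto (fun h : ℝ => (h : ℂ)⁻¹ • (S h x - x)) (𝓝[>] 0) (𝓝 y)

theorem HasGenerator.add {S : C0Semigroup E} {x y x' y' : E}
    (h : S.HasGenerator x y) (h' : S.HasGenerator x' y') :
    S.HasGenerator (x + x') (y + y') := by
  refine (Tendsto.add h h').congr fun t => ?_
  rw [← smul_add, _root_.map_add (S.toFun t)]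
  congr 1
  abel

theorem HasGenerator.smul {S : C0Semigroup E} {x y : E} (c : ℂ)
    (h : S.HasGenerator x y) : S.HasGenerator (c • x) (c • y) := by
  refine (Tendsto.const_smul h c).congr fun t => ?_
  rw [smul_comm, smul_sub, map_smul]

/-- The domain of the generator: the vectors whose orbit is differentiable at time `0`. -/
def generatorDomain (S : C0Semigroup E) : Submodule ℂ E where
  carrier := {x | ∃ y, S.HasGenerator x y}
  add_mem' := by
    rintro x x' ⟨y, h⟩ ⟨y', h'⟩
    exact ⟨y + y', h.add h'⟩
  zero_mem' := ⟨0, by simp [HasGenerator]⟩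
  smul_mem' := by
    rintro c x ⟨y, h⟩
    exact ⟨c • y, h.smul c⟩

/-- The infinitesimal generator `A x = lim_{h → 0+} (S h x - x) / h`, an unbounded operator. -/
noncomputable def generator (S : C0Semigroup E) : E →ₗ.[ℂ] E where
  domain := S.generatorDomain
  toFun :=
    { toFun := fun x => x.2.choose
      map_add' := fun x x' => tendsto_nhds_unique (x + x').2.choose_spec
        (HasGenerator.add x.2.choose_spec x'.2.choose_spec)
      map_smul' := fun c x => tendsto_nhds_unique (c • x).2.choose_spec
        (HasGenerator.smul c x.2.choose_spec) }

theorem mem_graph_generator_iff (S : C0Semigroup E) (x y : E) :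
    (x, y) ∈ S.generator.graph ↔ S.HasGenerator x y := by
  rw [LinearPMap.mem_graph_iff]
  constructor
  · rintro ⟨z, rfl, rfl⟩
    exact z.2.choose_spec
  · intro h
    have hx : x ∈ S.generatorDomain := ⟨y, h⟩
    exact ⟨⟨x, hx⟩, rfl, tendsto_nhds_unique hx.choose_spec h⟩

end C0Semigroup

namespace LinearPMap

variable {E : Type*} [NormedAddCommGroup E] [NormedSpace ℂ E]

/-- The bounded operator `R` is the two-sided inverse of `A - z : dom A → E`. -/
def IsResolventAt (A : E →ₗ.[ℂ] E) (z : ℂ) (R : E →L[ℂ] E) : Prop :=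
  (∀ y : E, ∃ x : A.domain, (x : E) = R y ∧ A x - z • (x : E) = y) ∧
    ∀ x : A.domain, R (A x - z • (x : E)) = x

/-- The resolvent set `ρ(A)` of an unbounded operator: the `z` for which `A - z : dom A → E` is
bijective with bounded inverse. -/
def rho (A : E →ₗ.[ℂ] E) : Set ℂ :=
  {z | ∃ R : E →L[ℂ] E, A.IsResolventAt z R}

open Classical in
/-- The resolvent `(A - z)⁻¹` for `z ∈ ρ(A)` (and `0` for other `z`). -/
noncomputable def resolventOp (A : E →ₗ.[ℂ] E) (z : ℂ) : E →L[ℂ] E :=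
  if h : z ∈ A.rho then h.choose else 0

theorem isResolventAt_resolventOp {A : E →ₗ.[ℂ] E} {z : ℂ} (h : z ∈ A.rho) :
    A.IsResolventAt z (A.resolventOp z) := by
  rw [resolventOp, dif_pos h]
  exact h.choose_spec

theorem IsResolventAt.eq {A : E →ₗ.[ℂ] E} {z : ℂ} {R R' : E →L[ℂ] E}
    (h : A.IsResolventAt z R) (h' : A.IsResolventAt z R') : R = R' := by
  ext y
  obtain ⟨x, hx, hy⟩ := h.1 y
  have := h'.2 x
  rw [hy] at this
  rw [this, hx]

end LinearPMap

/-!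
The decay of `T_Y e^{tA} T_X` is read off from the inverse Laplace transform of a power of the
resolvent `R(z) = (A - z)⁻¹`,
`t^{n} e^{tA} y = ± n! / (2πi) ∫_{Re z = a} e^{zt} R(z)^{n+1} y dz`,
on the line `a = 1 / t`, where `e^{zt}` has constant modulus `e`. Here `n = m + 1` if `κ ≠ 0`, and
`n = m + 2` if `κ = 0`, so that the assumed bound `C₀ |z|^p`, `p = m - κ - n < -1`, is integrable at
infinity along vertical lines.

* Low frequencies: between `T_Y` and `T_X`, the substitution `Im z = u / t` shows that the integral
  of `|z|^p` is of order `t^{-p-1} = t^{n-m-1+κ}`, which is the claim after division by `t^n`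
  (`norm_integral_le_of_norm_le_vline_rpow`).
* High frequencies: the integral is bounded, uniformly in `a`, already as an operator on the Hilbert
  space (`exists_norm_setIntegral_resolventOp_pow_le`). By Plancherel, `R(z) y` is square integrable
  on a line to the right of the growth bound, and dually an `L²` density can be integrated against
  `R(z)`; the resolvent identity and the bound on the resolvent carry both facts to the line
  `Re z = a`. As `n ≥ 1`, the power contains two resolvents, one for each of the two facts.

The formula is established on the line `Re z = ω + 1`, to the right of the growth bound `ω`, by
Fourier inversion, and moved to `Re z = a` by Cauchy's theorem. Both steps need decay of the
integrand and are done for `y` in the range of `R(ω + 1)²`. The comparison of `t^n e^{tA} y` with its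
low-frequency part then extends to all `y` by density
(`exists_norm_pow_smul_sub_integral_le`), in particular to `y = T_X x`. For `t ≤ 1` the exponential
bound on the semigroup is enough.
-/

open MeasureTheory FourierTransform SchwartzMap

/-! ### Plancherel's identity on L¹ ∩ L² -/

open scoped ContDiff in
/-- On `L¹ ∩ L²` the `L²` Fourier transform is the Fourier integral: both represent the same tempered
distribution. -/
theorem fourier_toLp_ae_eq {F : Type*} [NormedAddCommGroup F]
    [InnerProductSpace ℂ F] [CompleteSpace F] {f : ℝ → F} (hf : Integrable f)
    (hf2 : MemLp f 2) :
    ⇑(𝓕 (hf2.toLp f) : Lp F 2 (volume : Measure ℝ)) =ᵐ[volume] 𝓕 f := by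
  have hcont : Continuous (𝓕 f) := VectorFourier.fourierIntegral_continuous
    Real.continuous_fourierChar (L := innerₗ ℝ) continuous_inner hf
  refine ae_eq_of_integral_contDiff_smul_eq
    ((Lp.memLp _).locallyIntegrable (by norm_num)) hcont.locallyIntegrable ?_
  intro g hg hgc
  have hg' : HasCompactSupport (fun x => (g x : ℂ)) := hgc.comp_left Complex.ofReal_zero
  have hg2 : ContDiff ℝ ∞ (fun x => (g x : ℂ)) := Complex.ofRealCLM.contDiff.comp hg
  obtain ⟨φ, hφ⟩ : ∃ φ : 𝓢(ℝ, ℂ), ∀ x, φ x = (g x : ℂ) := ⟨hg'.toSchwartzMap hg2, fun x => rfl⟩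
  have h1 := DFunLike.congr_fun (Lp.fourier_toTemperedDistribution_eq (hf2.toLp f)) φ
  rw [TemperedDistribution.fourier_apply, Lp.toTemperedDistribution_apply,
    Lp.toTemperedDistribution_apply] at h1
  have h2 : ∫ x, (𝓕 φ) x • (hf2.toLp f) x = ∫ x, (𝓕 φ) x • f x :=
    integral_congr_ae (hf2.coeFn_toLp.mono fun x hx => by simp only [hx])
  have h3 : ∫ x, (𝓕 (φ : ℝ → ℂ)) x • f x = ∫ x, φ x • 𝓕 f x := by
    have hφi : Integrable (φ : ℝ → ℂ) := φ.integrable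
    simpa using! VectorFourier.integral_fourierIntegral_smul_eq_flip (L := innerₗ ℝ)
      Real.continuous_fourierChar continuous_inner hφi hf
  rw [h2, SchwartzMap.fourier_coe, h3] at h1
  simp only [hφ] at h1
  exact h1.symm

/-- Plancherel's identity for the Fourier integral of a function in `L¹ ∩ L²`. -/
theorem MeasureTheory.Integrable.eLpNorm_two_fourier_eq {F : Type*} [NormedAddCommGroup F]
    [InnerProductSpace ℂ F] [CompleteSpace F] {f : ℝ → F} (hf : Integrable f)
    (hf2 : MemLp f 2) : eLpNorm (𝓕 f) 2 = eLpNorm f 2 := by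
  rw [← eLpNorm_congr_ae (fourier_toLp_ae_eq hf hf2), ← eLpNorm_congr_ae hf2.coeFn_toLp]
  have := Lp.norm_fourier_eq (hf2.toLp f)
  rw [Lp.norm_def, Lp.norm_def] at this
  exact (ENNReal.toReal_eq_toReal_iff' (Lp.eLpNorm_ne_top _) (Lp.eLpNorm_ne_top _)).1 this

/-! ### Strongly continuous semigroups: growth and generator -/

namespace C0Semigroup

variable {E : Type*} [NormedAddCommGroup E] [NormedSpace ℂ E]

theorem continuous_orbit_max (S : C0Semigroup E) (x : E) :
    Continuous fun t : ℝ => S (max t 0) x := by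
  have := (S.continuousOn_orbit x).comp_continuous (f := fun t : ℝ => max t 0)
    (by fun_prop) (fun t => le_max_right t 0)
  exact this

/-- Uniform boundedness on `[0, 1]` and the semigroup law give an exponential bound. -/
theorem exists_norm_le_exp [CompleteSpace E] (S : C0Semigroup E) :
    ∃ M ω : ℝ, 1 ≤ M ∧ 0 ≤ ω ∧ ∀ t, 0 ≤ t → ‖S t‖ ≤ M * Real.exp (ω * t) := by
  obtain ⟨C, hC⟩ : ∃ C, ∀ i : Set.Icc (0 : ℝ) 1, ‖S (i : ℝ)‖ ≤ C := by
    refine banach_steinhaus fun x => ?_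
    obtain ⟨C, hC⟩ := isCompact_Icc.exists_bound_of_continuousOn
      ((S.continuousOn_orbit x).mono Set.Icc_subset_Ici_self)
    exact ⟨C, fun i => hC i i.2⟩
  set M := max C 1
  have hM1 : 1 ≤ M := le_max_right _ _
  have hM0 : 0 < M := by linarith
  have hM : ∀ t ∈ Set.Icc (0 : ℝ) 1, ‖S t‖ ≤ M := fun t ht =>
    (hC ⟨t, ht⟩).trans (le_max_left _ _)
  have step : ∀ k : ℕ, ∀ t ∈ Set.Icc (0 : ℝ) 1, ‖S (t + k)‖ ≤ M * M ^ k := by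
    intro k
    induction k with
    | zero => intro t ht; simpa using hM t ht
    | succ k ih =>
      intro t ht
      have : S (t + (k + 1 : ℕ)) = S (t + k) ∘L S 1 := by
        rw [← S.map_add _ _ (by have := ht.1; positivity) zero_le_one]; push_cast; ring_nf
      rw [this]
      calc _ ≤ ‖S (t + k)‖ * ‖S 1‖ := ContinuousLinearMap.opNorm_comp_le _ _
        _ ≤ M * M ^ k * M := by
          gcongr
          · exact ih t ht
          · exact hM 1 (by simp)
        _ = _ := by ring
  refine ⟨M, Real.log M, hM1, Real.log_nonneg hM1, fun t ht => ?_⟩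
  have h1 := step ⌊t⌋₊ (t - ⌊t⌋₊)
    ⟨by linarith [Nat.floor_le ht], by linarith [Nat.lt_floor_add_one t]⟩
  rw [sub_add_cancel] at h1
  refine h1.trans ?_
  gcongr
  rw [← Real.rpow_def_of_pos hM0, ← Real.rpow_natCast]
  exact Real.rpow_le_rpow_of_exponent_le hM1 (Nat.floor_le ht)

/-- Joint continuity in time and vector; `max p.1 0` keeps the time in the range where the semigroup
law holds. -/
theorem continuous_uncurry_max (S : C0Semigroup E) {M ω : ℝ}
    (hS : ∀ t, 0 ≤ t → ‖S t‖ ≤ M * Real.exp (ω * t)) :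
    Continuous fun p : ℝ × E => S (max p.1 0) p.2 := by
  rw [continuous_iff_continuousAt]
  rintro ⟨t, x⟩
  have h0 : Tendsto (fun p : ℝ × E => S (max p.1 0) x) (𝓝 (t, x)) (𝓝 (S (max t 0) x)) :=
    ((S.continuous_orbit_max x).comp continuous_fst).tendsto (t, x)
  have h1 : Tendsto (fun p : ℝ × E => S (max p.1 0) (p.2 - x)) (𝓝 (t, x)) (𝓝 0) := by
    have hb : Tendsto (fun p : ℝ × E => M * Real.exp (ω * max p.1 0) * ‖p.2 - x‖) (𝓝 (t, x))
        (𝓝 0) := by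
      have : Continuous (fun p : ℝ × E => M * Real.exp (ω * max p.1 0) * ‖p.2 - x‖) := by
        fun_prop
      simpa using this.tendsto (t, x)
    exact squeeze_zero_norm (fun p => (S _).le_of_opNorm_le (hS _ (le_max_right _ _)) _) hb
  have := h1.add h0
  simpa [ContinuousAt] using this

theorem hasGenerator_of_hasDerivAt {S : C0Semigroup E} {x y : E} {φ : ℝ → E}
    (hφ : HasDerivAt φ y 0) (h0 : φ 0 = x) (h : ∀ t, 0 < t → φ t = S t x) :
    S.HasGenerator x y := by
  have := (hasDerivAt_iff_tendsto_slope.1 hφ).mono_left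
    (nhdsWithin_mono 0 (show Set.Ioi (0 : ℝ) ⊆ {0}ᶜ from fun t ht => (ne_of_gt ht)))
  refine this.congr' ?_
  filter_upwards [self_mem_nhdsWithin] with t ht
  rw [slope_def_module, h t ht, h0, sub_zero, ← Complex.ofReal_inv, Complex.coe_smul]

theorem hasGenerator_intervalIntegral [CompleteSpace E] (S : C0Semigroup E) (x : E) {a : ℝ}
    (ha : 0 ≤ a) :
    S.HasGenerator (∫ s in (0 : ℝ)..a, S (max s 0) x) (S a x - x) := by
  set g : ℝ → E := fun s => S (max s 0) x
  have hg : Continuous g := S.continuous_orbit_max x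
  have hd : ∀ u, HasDerivAt (fun u => ∫ s in (0 : ℝ)..u, g s) (g u) u := fun u =>
    (hg.integral_hasStrictDerivAt 0 u).hasDerivAt
  have hda : HasDerivAt (fun h => ∫ s in (0 : ℝ)..(h + a), g s) (g a) 0 := by
    have := (hd (0 + a)).comp_add_const (x := (0 : ℝ)) (a := a)
    simpa using this
  have hga : g a = S a x := by simp [g, ha]
  have hg0 : g 0 = x := by simp [g, S.map_zero]
  refine hasGenerator_of_hasDerivAt
    (φ := fun h => (∫ s in (0 : ℝ)..(h + a), g s) - ∫ s in (0 : ℝ)..h, g s) ?_ (by simp) ?_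
  · have := hda.sub (hd 0)
    rw [hga, hg0] at this
    exact this
  · intro t ht
    show _ - _ = _
    rw [intervalIntegral.integral_interval_sub_left (hg.intervalIntegrable _ _)
      (hg.intervalIntegrable _ _), ← ContinuousLinearMap.intervalIntegral_comp_comm _
      (hg.intervalIntegrable _ _)]
    have := intervalIntegral.integral_comp_add_left (a := 0) (b := a) g t
    rw [add_zero] at this
    rw [← this]
    refine intervalIntegral.integral_congr fun s hs => ?_
    rw [Set.uIcc_of_le ha] at hs
    have hs0 := hs.1
    simp only [g]
    rw [max_eq_left hs0, max_eq_left (by positivity), S.map_add _ _ ht.le hs0]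
    rfl

/-- The averages `h⁻¹ ∫₀ʰ S(s) x ds` lie in the domain and tend to `x`. -/
theorem dense_generatorDomain [CompleteSpace E] (S : C0Semigroup E) :
    Dense (S.generatorDomain : Set E) := by
  intro x
  set g : ℝ → E := fun s => S (max s 0) x
  have hg : Continuous g := S.continuous_orbit_max x
  have hg0 : g 0 = x := by simp [g, S.map_zero]
  have hd : HasDerivAt (fun u => ∫ s in (0 : ℝ)..u, g s) (g 0) 0 :=
    (hg.integral_hasStrictDerivAt 0 0).hasDerivAt
  have := (hasDerivAt_iff_tendsto_slope.1 hd).mono_left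
    (nhdsWithin_mono 0 (show Set.Ioi (0 : ℝ) ⊆ {0}ᶜ from fun t ht => (ne_of_gt ht)))
  rw [hg0] at this
  refine mem_closure_of_tendsto this ?_
  filter_upwards [self_mem_nhdsWithin] with t ht
  rw [slope_def_module, intervalIntegral.integral_same, sub_zero, sub_zero, ← Complex.coe_smul]
  have hmem : (∫ s in (0 : ℝ)..t, g s) ∈ S.generatorDomain :=
    ⟨S t x - x, S.hasGenerator_intervalIntegral x (le_of_lt ht)⟩
  exact S.generatorDomain.smul_mem _ hmem

end C0Semigroup

/-! ### Resolvent identity and Laplace transform -/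

namespace LinearPMap

variable {E : Type*} [NormedAddCommGroup E] [NormedSpace ℂ E]

/-- The first resolvent identity. -/
theorem resolventOp_sub_resolventOp {A : E →ₗ.[ℂ] E} {z w : ℂ} (hz : z ∈ A.rho)
    (hw : w ∈ A.rho) :
    A.resolventOp z - A.resolventOp w = (z - w) • (A.resolventOp z * A.resolventOp w) := by
  ext y
  obtain ⟨x, hx, hy⟩ := (isResolventAt_resolventOp hw).1 y
  have h1 := (isResolventAt_resolventOp hz).2 x
  have h2 : A x - z • (x : E) = y - (z - w) • (x : E) := by
    rw [← hy, sub_smul]; abel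
  rw [h2, _root_.map_sub, _root_.map_smul] at h1
  change A.resolventOp z y - A.resolventOp w y = (z - w) • A.resolventOp z (A.resolventOp w y)
  rw [← hx]
  rw [sub_eq_iff_eq_add] at h1 ⊢
  rw [h1, add_comm]

end LinearPMap

/-- A pseudo-resolvent on `U`: a function satisfying the first resolvent identity, in the sign
convention of `(A - z)⁻¹`. -/
def IsPseudoResolventOn {B : Type*} [NormedRing B] [NormedAlgebra ℂ B] (R : ℂ → B) (U : Set ℂ) :
    Prop :=
  ∀ z ∈ U, ∀ w ∈ U, R z - R w = (z - w) • (R z * R w)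

namespace IsPseudoResolventOn

variable {B : Type*} [NormedRing B] [NormedAlgebra ℂ B] {R : ℂ → B} {U : Set ℂ}

theorem commute (h : IsPseudoResolventOn R U) {z w : ℂ} (hz : z ∈ U) (hw : w ∈ U) :
    Commute (R z) (R w) := by
  rcases eq_or_ne z w with rfl | hne
  · exact Commute.refl _
  · have h1 := h z hz w hw
    have h2 := h w hw z hz
    have h3 : (z - w) • (R z * R w) = (z - w) • (R w * R z) := by
      rw [← h1, ← neg_sub w z, neg_smul, ← h2, neg_sub]
    exact smul_right_injective B (sub_ne_zero.2 hne) h3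

theorem continuousAt (h : IsPseudoResolventOn R U) (hU : IsOpen U) {z : ℂ} (hz : z ∈ U) :
    ContinuousAt R z := by
  have hsmall : ∀ᶠ w in 𝓝 z, ‖w - z‖ * ‖R z‖ < 1 / 2 := by
    have : Continuous fun w : ℂ => ‖w - z‖ * ‖R z‖ := by fun_prop
    exact this.continuousAt.eventually_lt continuousAt_const (by simp)
  have hb : ∀ᶠ w in 𝓝 z, ‖R w - R z‖ ≤ ‖w - z‖ * (2 * ‖R z‖ * ‖R z‖) := by
    filter_upwards [hsmall, hU.mem_nhds hz] with w hw hwU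
    have h1 : ‖R w - R z‖ ≤ ‖w - z‖ * (‖R w‖ * ‖R z‖) := by
      rw [h w hwU z hz, norm_smul]
      gcongr
      exact norm_mul_le _ _
    have h2 : ‖R w‖ ≤ 2 * ‖R z‖ := by
      have h3 : ‖R w‖ ≤ ‖R z‖ + ‖R w - R z‖ := by
        simpa using norm_add_le (R z) (R w - R z)
      nlinarith [norm_nonneg (R w), norm_nonneg (R z)]
    exact h1.trans (by gcongr)
  rw [ContinuousAt, tendsto_iff_norm_sub_tendsto_zero]
  refine squeeze_zero' (Eventually.of_forall fun _ => norm_nonneg _) hb ?_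
  have : Continuous fun w : ℂ => ‖w - z‖ * (2 * ‖R z‖ * ‖R z‖) := by fun_prop
  simpa using this.tendsto z

theorem hasDerivAt (h : IsPseudoResolventOn R U) (hU : IsOpen U) {z : ℂ} (hz : z ∈ U) :
    HasDerivAt R (R z ^ 2) z := by
  rw [hasDerivAt_iff_tendsto_slope]
  have : Tendsto (fun w => R w * R z) (𝓝[≠] z) (𝓝 (R z ^ 2)) := by
    rw [sq]
    exact ((h.continuousAt hU hz).tendsto.mul_const _).mono_left nhdsWithin_le_nhds
  refine this.congr' ?_
  filter_upwards [self_mem_nhdsWithin, mem_nhdsWithin_of_mem_nhds (hU.mem_nhds hz)] with w hw hwU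
  rw [slope_def_module, h w hwU z hz, smul_smul, inv_mul_cancel₀ (sub_ne_zero.2 hw), one_smul]

theorem hasDerivAt_pow (h : IsPseudoResolventOn R U) (hU : IsOpen U) {z : ℂ} (hz : z ∈ U)
    (n : ℕ) : HasDerivAt (fun w => R w ^ (n + 1)) ((n + 1 : ℂ) • R z ^ (n + 2)) z := by
  induction n with
  | zero => simpa using h.hasDerivAt hU hz
  | succ n ih =>
    have := ih.mul (h.hasDerivAt hU hz)
    have e : ((n : ℂ) + 1) • R z ^ (n + 2) * R z + R z ^ (n + 1) * R z ^ 2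
        = (((n + 1 : ℕ) : ℂ) + 1) • R z ^ (n + 1 + 2) := by
      rw [smul_mul_assoc, ← pow_succ, ← pow_add, Nat.cast_succ,
        add_smul ((n : ℂ) + 1) (1 : ℂ), one_smul]
    rw [e] at this
    refine this.congr_of_eventuallyEq (Eventually.of_forall fun w => ?_)
    simp only [Pi.mul_apply]
    rw [← pow_succ]

end IsPseudoResolventOn

namespace C0Semigroup

variable {E : Type*} [NormedAddCommGroup E] [NormedSpace ℂ E] {S : C0Semigroup E} {M ω : ℝ}

theorem norm_cexp_smul_le (hS : ∀ t, 0 ≤ t → ‖S t‖ ≤ M * Real.exp (ω * t)) (z : ℂ) (x : E)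
    {t : ℝ} (ht : 0 ≤ t) :
    ‖Complex.exp (-z * t) • S t x‖ ≤ M * ‖x‖ * Real.exp (-(z.re - ω) * t) := by
  have hre : (-z * (t : ℂ)).re = -z.re * t := by simp
  rw [norm_smul, Complex.norm_exp, hre]
  calc _ ≤ Real.exp (-z.re * t) * (M * Real.exp (ω * t) * ‖x‖) := by
        gcongr
        exact (S t).le_of_opNorm_le (hS t ht) x
    _ = M * ‖x‖ * (Real.exp (-z.re * t) * Real.exp (ω * t)) := by ring
    _ = _ := by rw [← Real.exp_add]; ring_nf

theorem integrableOn_laplace (hS : ∀ t, 0 ≤ t → ‖S t‖ ≤ M * Real.exp (ω * t)) {z : ℂ}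
    (hz : ω < z.re) (x : E) :
    IntegrableOn (fun t : ℝ => Complex.exp (-z * t) • S (max t 0) x) (Set.Ioi 0) := by
  have hc : Continuous fun t : ℝ => Complex.exp (-z * t) • S (max t 0) x :=
    (by fun_prop : Continuous fun t : ℝ => Complex.exp (-z * t)).smul (S.continuous_orbit_max x)
  refine Integrable.mono' ((exp_neg_integrableOn_Ioi 0 (sub_pos.2 hz)).const_mul (M * ‖x‖))
    hc.aestronglyMeasurable ?_
  filter_upwards [self_mem_ae_restrict measurableSet_Ioi] with t ht
  rw [max_eq_left (le_of_lt ht)]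
  exact norm_cexp_smul_le hS z x (le_of_lt ht)

/-- The Laplace transform `Q` of the orbit of `x` lies in the domain, and `A Q = z Q - x`. Here
`S(h) Q = e^{zh} (Q - ∫₀ʰ e^{-zt} S(t) x dt)`, whose derivative at `h = 0` is `z Q - x`. -/
theorem hasGenerator_laplace [CompleteSpace E]
    (hS : ∀ t, 0 ≤ t → ‖S t‖ ≤ M * Real.exp (ω * t)) {z : ℂ}
    (hz : ω < z.re) (x : E) :
    S.HasGenerator (∫ t in Set.Ioi (0 : ℝ), Complex.exp (-z * t) • S (max t 0) x)
      (z • (∫ t in Set.Ioi (0 : ℝ), Complex.exp (-z * t) • S (max t 0) x) - x) := by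
  have hi := integrableOn_laplace hS hz x
  set g : ℝ → E := fun t => Complex.exp (-z * t) • S (max t 0) x with hg_def
  set Q := ∫ t in Set.Ioi (0 : ℝ), g t
  have hc : Continuous g :=
    (by fun_prop : Continuous fun t : ℝ => Complex.exp (-z * t)).smul (S.continuous_orbit_max x)
  have hg0 : g 0 = x := by simp [g, S.map_zero]
  refine hasGenerator_of_hasDerivAt
    (φ := fun h : ℝ => Complex.exp (z * h) • (Q - ∫ t in (0 : ℝ)..h, g t)) ?_ (by simp) ?_
  · have h1 : HasDerivAt (fun h : ℝ => Complex.exp (z * h)) z 0 := by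
      have : HasDerivAt (fun h : ℂ => Complex.exp (z * h)) z ((0 : ℝ) : ℂ) := by
        simpa using ((hasDerivAt_id (0 : ℂ)).const_mul z).cexp
      exact this.comp_ofReal
    have h2 := h1.smul ((hc.integral_hasStrictDerivAt 0 0).hasDerivAt.const_sub Q)
    refine h2.congr_deriv ?_
    simp [hg0, sub_eq_add_neg, add_comm]
  · intro h hh
    have h1 : Q - ∫ t in (0 : ℝ)..h, g t = ∫ t in Set.Ioi h, g t := by
      rw [sub_eq_iff_eq_add, add_comm]
      exact (intervalIntegral.integral_interval_add_Ioi (by simpa using hi)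
        (hi.mono_set (Set.Ioi_subset_Ioi hh.le))).symm
    have h2 : ∫ t in Set.Ioi h, g t = ∫ t in Set.Ioi (0 : ℝ), g (t + h) := by
      have := (measurePreserving_add_right volume h).setIntegral_preimage_emb
        (measurableEmbedding_addRight h) g (Set.Ioi h)
      simpa using this.symm
    show Complex.exp (z * h) • (Q - _) = _
    rw [h1, h2, ← integral_smul, ← ContinuousLinearMap.integral_comp_comm _ hi]
    refine setIntegral_congr_fun measurableSet_Ioi fun t ht => ?_
    have ht0 : 0 ≤ t := le_of_lt ht
    simp only [hg_def]
    rw [max_eq_left ht0, max_eq_left (by positivity), map_smul, smul_smul, ← Complex.exp_add,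
      add_comm t h, S.map_add _ _ hh.le ht0]
    rw [ContinuousLinearMap.comp_apply]
    congr 2
    push_cast
    ring

/-- To the right of the growth bound the resolvent is minus the Laplace transform of the semigroup;
that `z` lies in the resolvent set is assumed, so only one half of the inversion is needed. -/
theorem resolventOp_apply_eq_laplace [CompleteSpace E]
    (hS : ∀ t, 0 ≤ t → ‖S t‖ ≤ M * Real.exp (ω * t)) {z : ℂ}
    (hz : ω < z.re) (hzρ : z ∈ S.generator.rho) (x : E) :
    S.generator.resolventOp z x
      = -∫ t in Set.Ioi (0 : ℝ), Complex.exp (-z * t) • S (max t 0) x := by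
  have h := (S.mem_graph_generator_iff _ _).2 (hasGenerator_laplace hS hz x)
  obtain ⟨q, hq1, hq2⟩ := (LinearPMap.mem_graph_iff _).1 h
  have h3 := (LinearPMap.isResolventAt_resolventOp hzρ).2 q
  dsimp only at hq1 hq2
  rw [hq2, hq1, sub_sub_cancel_left, map_neg] at h3
  rw [← h3, neg_neg]

theorem denseRange_resolventOp [CompleteSpace E] {z : ℂ} (hz : z ∈ S.generator.rho) :
    DenseRange (S.generator.resolventOp z) := by
  refine S.dense_generatorDomain.mono fun x hx => ?_
  exact ⟨_, (LinearPMap.isResolventAt_resolventOp hz).2 ⟨x, hx⟩⟩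

end C0Semigroup

/-! ### Vertical lines and damped orbits -/

/-- The point `a + 2πiξ` of the vertical line `Re z = a`, parametrised by the frequency `ξ` of
Mathlib's Fourier transform. -/
noncomputable def vline (a ξ : ℝ) : ℂ := a + (2 * Real.pi * ξ : ℝ) * Complex.I

@[simp] theorem vline_re (a ξ : ℝ) : (vline a ξ).re = a := by simp [vline]

@[simp] theorem vline_im (a ξ : ℝ) : (vline a ξ).im = 2 * Real.pi * ξ := by simp [vline]

theorem continuous_vline (a : ℝ) : Continuous (vline a) := by unfold vline; fun_prop

theorem hasDerivAt_vline (a ξ : ℝ) : HasDerivAt (vline a) (2 * Real.pi * Complex.I) ξ := by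
  have h : HasDerivAt (fun z : ℂ => (a : ℂ) + 2 * Real.pi * z * Complex.I)
      (2 * Real.pi * Complex.I) (ξ : ℂ) := by
    simpa using (((hasDerivAt_id (ξ : ℂ)).const_mul (2 * Real.pi : ℂ)).mul_const
      Complex.I).const_add (a : ℂ)
  have := h.comp_ofReal
  unfold vline
  simpa using this

/-- The exponential `t ↦ e^{-t}` on `t > 0`, extended by zero. -/
noncomputable def expDecay : ℝ → ℝ := (Set.Ioi 0).indicator fun t => Real.exp (-t)

theorem expDecay_of_pos {t : ℝ} (ht : 0 < t) : expDecay t = Real.exp (-t) :=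
  Set.indicator_of_mem (Set.mem_Ioi.2 ht) _

theorem expDecay_of_nonpos {t : ℝ} (ht : t ≤ 0) : expDecay t = 0 :=
  Set.indicator_of_notMem (by simpa using ht) _

theorem integrable_pow_mul_expDecay (n : ℕ) : Integrable fun t => t ^ n * expDecay t := by
  have h : IntegrableOn (fun t : ℝ => t ^ n * Real.exp (-t)) (Set.Ioi 0) := by
    have := Real.GammaIntegral_convergent (s := n + 1) (by positivity)
    refine this.congr_fun (fun t _ => ?_) measurableSet_Ioi
    simp [mul_comm]
  refine (h.integrable_indicator measurableSet_Ioi).congr (Eventually.of_forall fun t => ?_)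
  rcases lt_or_ge 0 t with ht | ht
  · simp [expDecay_of_pos ht, ht]
  · simp [expDecay_of_nonpos ht, ht]

theorem integrable_expDecay : Integrable expDecay := by
  simpa using integrable_pow_mul_expDecay 0

theorem memLp_two_expDecay : MemLp expDecay 2 := by
  refine (memLp_two_iff_integrable_sq integrable_expDecay.aestronglyMeasurable).2 ?_
  refine integrable_expDecay.mono (integrable_expDecay.aestronglyMeasurable.pow 2)
    (Eventually.of_forall fun t => ?_)
  rcases lt_or_ge 0 t with ht | ht
  · rw [expDecay_of_pos ht, norm_pow]
    refine pow_le_of_le_one (norm_nonneg _) ?_ (by norm_num)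
    simpa using ht.le
  · simp [expDecay_of_nonpos ht]

namespace C0Semigroup

variable {E : Type*} [NormedAddCommGroup E] [NormedSpace ℂ E]

/-- The orbit of `x` damped by `e^{-μt}`, extended by zero to negative times. -/
noncomputable def dampedOrbit (S : C0Semigroup E) (μ : ℝ) (x : E) : ℝ → E :=
  (Set.Ioi 0).indicator fun t => Complex.exp (-(μ : ℂ) * t) • S (max t 0) x

variable {S : C0Semigroup E} {M ω : ℝ}

theorem dampedOrbit_of_pos (μ : ℝ) (x : E) {t : ℝ} (ht : 0 < t) :
    S.dampedOrbit μ x t = Complex.exp (-(μ : ℂ) * t) • S t x := by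
  rw [dampedOrbit, Set.indicator_of_mem (Set.mem_Ioi.2 ht), max_eq_left ht.le]

theorem dampedOrbit_of_nonpos (μ : ℝ) (x : E) {t : ℝ} (ht : t ≤ 0) :
    S.dampedOrbit μ x t = 0 :=
  Set.indicator_of_notMem (by simpa using ht) _

theorem continuous_exp_smul_orbit (S : C0Semigroup E) (z : ℂ) (x : E) :
    Continuous fun t : ℝ => Complex.exp (-z * t) • S (max t 0) x :=
  (by fun_prop : Continuous fun t : ℝ => Complex.exp (-z * t)).smul (S.continuous_orbit_max x)

theorem aestronglyMeasurable_dampedOrbit (μ : ℝ) (x : E) :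
    AEStronglyMeasurable (S.dampedOrbit μ x) :=
  (S.continuous_exp_smul_orbit μ x).aestronglyMeasurable.indicator measurableSet_Ioi

theorem norm_dampedOrbit_le (hS : ∀ t, 0 ≤ t → ‖S t‖ ≤ M * Real.exp (ω * t)) (x : E) (t : ℝ) :
    ‖S.dampedOrbit (ω + 1) x t‖ ≤ M * ‖x‖ * expDecay t := by
  rcases lt_or_ge 0 t with ht | ht
  · rw [dampedOrbit_of_pos _ _ ht, expDecay_of_pos ht]
    simpa using norm_cexp_smul_le hS ((ω + 1 : ℝ) : ℂ) x ht.le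
  · simp [dampedOrbit_of_nonpos _ _ ht, expDecay_of_nonpos ht]

theorem integrable_pow_smul_dampedOrbit (hS : ∀ t, 0 ≤ t → ‖S t‖ ≤ M * Real.exp (ω * t)) (x : E)
    (n : ℕ) : Integrable fun t : ℝ => t ^ n • S.dampedOrbit (ω + 1) x t := by
  refine ((integrable_pow_mul_expDecay n).const_mul (M * ‖x‖)).mono
    ((by fun_prop : Continuous fun t : ℝ => t ^ n).aestronglyMeasurable.smul
      (aestronglyMeasurable_dampedOrbit _ _)) (Eventually.of_forall fun t => ?_)
  rw [norm_smul, norm_mul (M * ‖x‖), norm_mul (t ^ n), mul_left_comm]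
  gcongr
  refine (norm_dampedOrbit_le hS x t).trans ?_
  rw [← norm_mul]
  exact Real.le_norm_self _

theorem integrable_dampedOrbit (hS : ∀ t, 0 ≤ t → ‖S t‖ ≤ M * Real.exp (ω * t)) (x : E) :
    Integrable (S.dampedOrbit (ω + 1) x) := by
  simpa using integrable_pow_smul_dampedOrbit hS x 0

theorem eLpNorm_dampedOrbit_le (hS : ∀ t, 0 ≤ t → ‖S t‖ ≤ M * Real.exp (ω * t)) (x : E) :
    eLpNorm (S.dampedOrbit (ω + 1) x) 2 ≤ ENNReal.ofReal (M * ‖x‖) * eLpNorm expDecay 2 :=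
  eLpNorm_le_mul_eLpNorm_of_ae_le_mul (Eventually.of_forall fun t => by
    refine (norm_dampedOrbit_le hS x t).trans_eq ?_
    congr 1
    rcases lt_or_ge 0 t with ht | ht
    · rw [expDecay_of_pos ht]; simp
    · simp [expDecay_of_nonpos ht]) 2

theorem memLp_two_dampedOrbit (hS : ∀ t, 0 ≤ t → ‖S t‖ ≤ M * Real.exp (ω * t)) (x : E) :
    MemLp (S.dampedOrbit (ω + 1) x) 2 :=
  ⟨aestronglyMeasurable_dampedOrbit _ _, (eLpNorm_dampedOrbit_le hS x).trans_lt
    (ENNReal.mul_lt_top ENNReal.ofReal_lt_top memLp_two_expDecay.2)⟩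

variable [CompleteSpace E]

theorem fourier_dampedOrbit (hS : ∀ t, 0 ≤ t → ‖S t‖ ≤ M * Real.exp (ω * t))
    (hρ : {z : ℂ | 0 < z.re} ⊆ S.generator.rho) (hω : 0 ≤ ω) (x : E) (ξ : ℝ) :
    𝓕 (S.dampedOrbit (ω + 1) x) ξ = -S.generator.resolventOp (vline (ω + 1) ξ) x := by
  have hre : ω < (vline (ω + 1) ξ).re := by simp
  rw [resolventOp_apply_eq_laplace hS hre (hρ (hω.trans_lt hre)), neg_neg,
    Real.fourier_real_eq_integral_exp_smul, ← integral_indicator measurableSet_Ioi]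
  refine integral_congr_ae (Eventually.of_forall fun t => ?_)
  rcases lt_or_ge 0 t with ht | ht
  · simp only [dampedOrbit_of_pos _ _ ht, Set.indicator_of_mem (Set.mem_Ioi.2 ht),
      max_eq_left ht.le, smul_smul, ← Complex.exp_add]
    congr 2
    simp only [vline]
    push_cast
    ring
  · simp [dampedOrbit_of_nonpos _ _ ht, ht]

end C0Semigroup

/-! ### Square integrability of the resolvent and its dual form -/

namespace C0Semigroup

variable {K : Type*} [NormedAddCommGroup K] [InnerProductSpace ℂ K] [CompleteSpace K]
  {S : C0Semigroup K} {M ω : ℝ}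

/-- Plancherel applied to the damped orbit: on the line `Re z = ω + 1` the function `R(z) x` is
square integrable, with norm controlled by `‖x‖`. -/
theorem eLpNorm_resolventOp_vline_le (hS : ∀ t, 0 ≤ t → ‖S t‖ ≤ M * Real.exp (ω * t))
    (hρ : {z : ℂ | 0 < z.re} ⊆ S.generator.rho) (hω : 0 ≤ ω) (x : K) :
    eLpNorm (fun ξ => S.generator.resolventOp (vline (ω + 1) ξ) x) 2
      ≤ ENNReal.ofReal (M * ‖x‖) * eLpNorm expDecay 2 := by
  have h : (fun ξ => S.generator.resolventOp (vline (ω + 1) ξ) x)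
      = -𝓕 (S.dampedOrbit (ω + 1) x) := by
    ext ξ
    rw [Pi.neg_apply, fourier_dampedOrbit hS hρ hω, neg_neg]
  rw [h, eLpNorm_neg, (integrable_dampedOrbit hS x).eLpNorm_two_fourier_eq
    (memLp_two_dampedOrbit hS x)]
  exact eLpNorm_dampedOrbit_le hS x

/-- Fubini: integrating `R(z) G` along the line `Re z = ω + 1` amounts to integrating the damped
semigroup against the Fourier transform of `G`. -/
theorem integral_resolventOp_vline_apply (hS : ∀ t, 0 ≤ t → ‖S t‖ ≤ M * Real.exp (ω * t))
    (hρ : {z : ℂ | 0 < z.re} ⊆ S.generator.rho) (hω : 0 ≤ ω) {G : ℝ → K} (hG : Integrable G) :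
    ∫ ξ, S.generator.resolventOp (vline (ω + 1) ξ) (G ξ)
      = -∫ t in Set.Ioi (0 : ℝ), Complex.exp (-((ω + 1 : ℝ) : ℂ) * t) • S (max t 0) (𝓕 G t) := by
  have h1 : ∀ ξ, S.generator.resolventOp (vline (ω + 1) ξ) (G ξ)
      = -∫ t in Set.Ioi (0 : ℝ), Complex.exp (-vline (ω + 1) ξ * t) • S (max t 0) (G ξ) := by
    intro ξ
    have hre : ω < (vline (ω + 1) ξ).re := by simp
    exact resolventOp_apply_eq_laplace hS hre (hρ (hω.trans_lt hre)) _
  simp_rw [h1]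
  rw [integral_neg, integral_integral_swap]
  · congr 1
    refine setIntegral_congr_fun measurableSet_Ioi fun t ht => ?_
    rw [Real.fourier_real_eq_integral_exp_smul, ← ContinuousLinearMap.integral_comp_comm,
      ← integral_smul]
    · refine integral_congr_ae (Eventually.of_forall fun ξ => ?_)
      simp only [map_smul, smul_smul, ← Complex.exp_add]
      congr 2
      simp only [vline]
      push_cast
      ring
    · have := (Real.fourierIntegral_convergent_iff t).2 hG
      refine this.congr (Eventually.of_forall fun ξ => ?_)
      simp only [Circle.smul_def, Real.fourierChar_apply]
      congr 2
      simp
      ring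
  · have hmeas : AEStronglyMeasurable (Function.uncurry fun (ξ t : ℝ) =>
        Complex.exp (-vline (ω + 1) ξ * t) • S (max t 0) (G ξ))
        (volume.prod (volume.restrict (Set.Ioi 0))) := by
      refine AEStronglyMeasurable.smul (Continuous.aestronglyMeasurable ?_) ?_
      · have := continuous_vline (ω + 1)
        fun_prop
      · exact (S.continuous_uncurry_max hS).comp_aestronglyMeasurable
          (measurable_snd.aestronglyMeasurable.prodMk hG.aestronglyMeasurable.comp_fst)
    have hbound : Integrable (fun p : ℝ × ℝ => (M * ‖G p.1‖) * expDecay p.2)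
        (volume.prod (volume.restrict (Set.Ioi 0))) :=
      (hG.norm.const_mul M).mul_prod integrable_expDecay.restrict
    refine hbound.mono' hmeas ?_
    have hae : ∀ᵐ p : ℝ × ℝ ∂(volume.prod (volume.restrict (Set.Ioi 0))), p.2 ∈ Set.Ioi (0 : ℝ) :=
      Measure.quasiMeasurePreserving_snd.ae (ae_restrict_mem measurableSet_Ioi)
    filter_upwards [hae] with p hp
    have hp' : 0 < p.2 := hp
    simp only [Function.uncurry]
    rw [max_eq_left hp'.le, expDecay_of_pos hp']
    simpa using norm_cexp_smul_le hS (vline (ω + 1) p.1) (G p.1) hp'.le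

/-- The dual form of the square integrability of the resolvent: a density `G ∈ L²` is integrated
against the resolvent with an `L²` bound. This replaces the adjoint semigroup. -/
theorem enorm_integral_resolventOp_vline_apply_le
    (hS : ∀ t, 0 ≤ t → ‖S t‖ ≤ M * Real.exp (ω * t))
    (hρ : {z : ℂ | 0 < z.re} ⊆ S.generator.rho) (hω : 0 ≤ ω) {G : ℝ → K} (hG : Integrable G)
    (hG2 : MemLp G 2) :
    ‖∫ ξ, S.generator.resolventOp (vline (ω + 1) ξ) (G ξ)‖ₑ
      ≤ ENNReal.ofReal M * eLpNorm expDecay 2 * eLpNorm G 2 := by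
  rw [integral_resolventOp_vline_apply hS hρ hω hG, enorm_neg]
  have hcont : Continuous (𝓕 G) := VectorFourier.fourierIntegral_continuous
    Real.continuous_fourierChar (L := innerₗ ℝ) continuous_inner hG
  calc _ ≤ ∫⁻ t in Set.Ioi (0 : ℝ),
          ‖Complex.exp (-((ω + 1 : ℝ) : ℂ) * t) • S (max t 0) (𝓕 G t)‖ₑ :=
        enorm_integral_le_lintegral_enorm _
    _ ≤ ∫⁻ t in Set.Ioi (0 : ℝ), ENNReal.ofReal M * ‖expDecay t • 𝓕 G t‖ₑ := by
        refine setLIntegral_mono' measurableSet_Ioi fun t ht => ?_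
        have ht0 : 0 < t := ht
        rw [max_eq_left ht0.le, ← ofReal_norm, ← ofReal_norm,
          ← ENNReal.ofReal_mul' (norm_nonneg _)]
        refine ENNReal.ofReal_le_ofReal ?_
        refine (norm_cexp_smul_le hS _ _ ht0.le).trans_eq ?_
        rw [expDecay_of_pos ht0, norm_smul, Real.norm_of_nonneg (Real.exp_pos _).le]
        simp only [Complex.ofReal_re, add_sub_cancel_left]
        ring_nf
    _ ≤ ∫⁻ t, ENNReal.ofReal M * ‖expDecay t • 𝓕 G t‖ₑ := setLIntegral_le_lintegral _ _
    _ = ENNReal.ofReal M * eLpNorm (expDecay • 𝓕 G) 1 := by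
        rw [lintegral_const_mul' _ _ ENNReal.ofReal_ne_top, eLpNorm_one_eq_lintegral_enorm]
        rfl
    _ ≤ ENNReal.ofReal M * (eLpNorm expDecay 2 * eLpNorm (𝓕 G) 2) := by
        gcongr
        exact eLpNorm_smul_le_mul_eLpNorm hcont.aestronglyMeasurable
          integrable_expDecay.aestronglyMeasurable
    _ = _ := by rw [hG.eLpNorm_two_fourier_eq hG2, mul_assoc]

end C0Semigroup

/-! ### The high-frequency estimate -/

theorem vline_sub_vline (a b ξ : ℝ) : vline a ξ - vline b ξ = ((a - b : ℝ) : ℂ) := by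
  simp [vline]

theorem abs_le_norm_vline (a ξ : ℝ) : |2 * Real.pi * ξ| ≤ ‖vline a ξ‖ := by
  simpa using Complex.abs_im_le_norm (vline a ξ)

theorem norm_cexp_vline_mul (a ξ t : ℝ) :
    ‖Complex.exp (vline a ξ * t)‖ = Real.exp (a * t) := by
  rw [Complex.norm_exp]; simp

theorem isOpen_re_pos : IsOpen {z : ℂ | 0 < z.re} :=
  isOpen_lt continuous_const Complex.continuous_re

theorem IsPseudoResolventOn.continuous_vline {B : Type*} [NormedRing B] [NormedAlgebra ℂ B]
    {R : ℂ → B} (h : IsPseudoResolventOn R {z : ℂ | 0 < z.re}) {a : ℝ} (ha : 0 < a) :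
    Continuous fun ξ => R (vline a ξ) :=
  continuous_iff_continuousAt.2 fun ξ =>
    (h.continuousAt isOpen_re_pos (z := vline a ξ) (by simpa using ha)).comp
      (_root_.continuous_vline a).continuousAt

theorem LinearPMap.isPseudoResolventOn_resolventOp {E : Type*} [NormedAddCommGroup E]
    [NormedSpace ℂ E] {A : E →ₗ.[ℂ] E} {U : Set ℂ} (hU : U ⊆ A.rho) :
    IsPseudoResolventOn A.resolventOp U :=
  fun _ hz _ hw => resolventOp_sub_resolventOp (hU hz) (hU hw)

theorem ContinuousLinearMap.opNorm_pow_le {E : Type*} [SeminormedAddCommGroup E] [NormedSpace ℂ E]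
    (T : E →L[ℂ] E) (n : ℕ) : ‖T ^ n‖ ≤ ‖T‖ ^ n := by
  induction n with
  | zero => rw [pow_zero, pow_zero]; exact ContinuousLinearMap.norm_id_le
  | succ n ih =>
    rw [pow_succ, pow_succ]
    exact (ContinuousLinearMap.opNorm_comp_le _ _).trans (by gcongr)

namespace IsPseudoResolventOn

variable {B : Type*} [NormedRing B] [NormedAlgebra ℂ B] {R : ℂ → B} {U : Set ℂ}

theorem eq_mul_one_sub (h : IsPseudoResolventOn R U) {z w : ℂ} (hz : z ∈ U) (hw : w ∈ U) :
    R z = R w * (1 - (w - z) • R z) := by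
  rw [mul_sub, mul_one, mul_smul_comm, ← h w hw z hz, sub_sub_cancel]

theorem eq_one_sub_mul (h : IsPseudoResolventOn R U) {z w : ℂ} (hz : z ∈ U) (hw : w ∈ U) :
    R z = (1 - (w - z) • R z) * R w := by
  rw [sub_mul, one_mul, smul_mul_assoc, ← (h.commute hw hz).eq, ← h w hw z hz, sub_sub_cancel]

end IsPseudoResolventOn

/-- On two vertical lines `Re z = a ≤ b`, a power `R(z)^{k+2}` on the first line factors through
the resolvent on the second one, which appears once on the left and, in norm, once on the right. -/
theorem IsPseudoResolventOn.exists_factor {K : Type*} [NormedAddCommGroup K] [NormedSpace ℂ K]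
    {R : ℂ → K →L[ℂ] K} (hR : IsPseudoResolventOn R {z : ℂ | 0 < z.re}) {N τ : ℝ}
    (hN : ∀ z : ℂ, 0 < z.re → τ ≤ ‖z‖ → ‖R z‖ ≤ N) (k : ℕ) {a b : ℝ} (ha : 0 < a) (hab : a ≤ b)
    (t : ℝ) (y : K) :
    ∃ g : ℝ → K, Continuous g ∧
      (∀ ξ, R (vline b ξ) (g ξ) = Complex.exp (vline a ξ * t) • (R (vline a ξ) ^ (k + 2)) y) ∧
      ∀ ξ, τ ≤ |2 * Real.pi * ξ| → ‖g ξ‖ ≤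
        Real.exp (a * t) * ((1 + b * N) * (N ^ k * (1 + b * N))) * ‖R (vline b ξ) y‖ := by
  have hpa : ∀ ξ, vline a ξ ∈ {z : ℂ | 0 < z.re} := fun ξ => by
    change 0 < (vline a ξ).re
    rwa [vline_re]
  have hpb : ∀ ξ, vline b ξ ∈ {z : ℂ | 0 < z.re} := fun ξ => by
    change 0 < (vline b ξ).re
    rw [vline_re]; linarith
  obtain ⟨T, hT⟩ : ∃ T : ℝ → K →L[ℂ] K, ∀ ξ, T ξ = 1 - (vline b ξ - vline a ξ) • R (vline a ξ) :=
    ⟨_, fun _ => rfl⟩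
  have hleft : ∀ ξ, R (vline a ξ) = R (vline b ξ) * T ξ := fun ξ => by
    rw [hT]; exact hR.eq_mul_one_sub (hpa ξ) (hpb ξ)
  have hright : ∀ ξ, R (vline a ξ) = T ξ * R (vline b ξ) := fun ξ => by
    rw [hT]; exact hR.eq_one_sub_mul (hpa ξ) (hpb ξ)
  have hcR : Continuous fun ξ => R (vline a ξ) := hR.continuous_vline ha
  have hcT : Continuous T := by
    rw [funext hT]
    exact continuous_const.sub (((_root_.continuous_vline b).sub (_root_.continuous_vline a)).smul hcR)
  refine ⟨fun ξ => Complex.exp (vline a ξ * t) • (T ξ * R (vline a ξ) ^ (k + 1)) y, ?_, ?_, ?_⟩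
  · refine Continuous.smul ?_ ((hcT.mul (hcR.pow (k + 1))).clm_apply continuous_const)
    exact Complex.continuous_exp.comp ((_root_.continuous_vline a).mul continuous_const)
  · intro ξ
    rw [map_smul, ← mul_apply_eq_comp, ← mul_assoc, ← hleft, ← pow_succ']
  · intro ξ hξ
    have hRN : ‖R (vline a ξ)‖ ≤ N := hN _ (hpa ξ) (hξ.trans (abs_le_norm_vline a ξ))
    have hN0 : 0 ≤ N := (norm_nonneg _).trans hRN
    have hTq : ‖T ξ‖ ≤ 1 + b * N := by
      rw [hT]
      refine (norm_sub_le _ _).trans (add_le_add ContinuousLinearMap.norm_id_le ?_)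
      rw [norm_smul, vline_sub_vline, Complex.norm_of_nonneg (by linarith)]
      gcongr
      · linarith
      · linarith
    have hb : 0 ≤ 1 + b * N := (norm_nonneg _).trans hTq
    have h1 : (T ξ * R (vline a ξ) ^ (k + 1)) y
        = (T ξ * (R (vline a ξ) ^ k * T ξ)) (R (vline b ξ) y) := by
      rw [← mul_apply_eq_comp, mul_assoc, mul_assoc, ← hright, ← pow_succ]
    rw [norm_smul, norm_cexp_vline_mul, h1, mul_assoc (Real.exp _)]
    refine mul_le_mul_of_nonneg_left ?_ (Real.exp_pos _).le
    refine ContinuousLinearMap.le_of_opNorm_le _ ?_ _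
    refine (norm_mul_le _ _).trans (mul_le_mul hTq ?_ (norm_nonneg _) hb)
    refine (norm_mul_le _ _).trans (mul_le_mul ?_ hTq (norm_nonneg _) (by positivity))
    exact (ContinuousLinearMap.opNorm_pow_le _ k).trans (by gcongr)

namespace C0Semigroup

variable {K : Type*} [NormedAddCommGroup K] [InnerProductSpace ℂ K] [CompleteSpace K]
  {S : C0Semigroup K} {M ω : ℝ}

/-- The high-frequency estimate: over frequencies where the resolvent is bounded, the integral of
`e^{zt} R(z)^{k+2} y` on `Re z = a` is bounded uniformly in the line and in the set of frequencies.
Of the `k + 2` factors, one is integrated by square integrability and one by its dual form. -/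
theorem exists_norm_setIntegral_resolventOp_pow_le
    (hM : 0 ≤ M) (hS : ∀ t, 0 ≤ t → ‖S t‖ ≤ M * Real.exp (ω * t))
    (hρ : {z : ℂ | 0 < z.re} ⊆ S.generator.rho) (hω : 0 ≤ ω) {N τ : ℝ} (hN0 : 0 ≤ N)
    (hN : ∀ z : ℂ, 0 < z.re → τ ≤ ‖z‖ → ‖S.generator.resolventOp z‖ ≤ N) (k : ℕ) :
    ∃ C : ℝ, 0 ≤ C ∧ ∀ a t : ℝ, 0 < a → a ≤ ω + 1 → ∀ B : Set ℝ, MeasurableSet B →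
      Bornology.IsBounded B → (∀ ξ ∈ B, τ ≤ |2 * Real.pi * ξ|) → ∀ y : K,
      ‖∫ ξ in B, Complex.exp (vline a ξ * t) • (S.generator.resolventOp (vline a ξ) ^ (k + 2)) y‖
        ≤ C * Real.exp (a * t) * ‖y‖ := by
  set e := (eLpNorm expDecay 2).toReal
  have he : eLpNorm expDecay 2 = ENNReal.ofReal e :=
    (ENNReal.ofReal_toReal memLp_two_expDecay.2.ne).symm
  have he0 : 0 ≤ e := ENNReal.toReal_nonneg
  set q := (1 + (ω + 1) * N) * (N ^ k * (1 + (ω + 1) * N))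
  have hq : 0 ≤ q := by positivity
  refine ⟨M * e * q * (M * e), by positivity, fun a t ha haω B hB hBb hBτ y => ?_⟩
  obtain ⟨g, hgc, hgR, hgq⟩ := (LinearPMap.isPseudoResolventOn_resolventOp hρ).exists_factor
    hN k ha haω t y
  set G : ℝ → K := B.indicator g with hG
  have hGle : ∀ ξ, ‖G ξ‖ ≤ Real.exp (a * t) * q *
      ‖S.generator.resolventOp (vline (ω + 1) ξ) y‖ := by
    intro ξ
    by_cases hξ : ξ ∈ B
    · rw [hG, Set.indicator_of_mem hξ]
      exact hgq ξ (hBτ ξ hξ)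
    · rw [hG, Set.indicator_of_notMem hξ, norm_zero]
      positivity
  have hG1 : Integrable G := by
    refine IntegrableOn.integrable_indicator ?_ hB
    exact (hgc.continuousOn.integrableOn_compact hBb.isCompact_closure).mono_set subset_closure
  have hGnorm : eLpNorm G 2 ≤ ENNReal.ofReal (Real.exp (a * t) * q * (M * ‖y‖ * e)) := by
    refine (eLpNorm_le_mul_eLpNorm_of_ae_le_mul (Eventually.of_forall hGle) 2).trans ?_
    rw [ENNReal.ofReal_mul (p := Real.exp (a * t) * q) (by positivity)]
    gcongr
    refine (eLpNorm_resolventOp_vline_le hS hρ hω y).trans_eq ?_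
    rw [he, ENNReal.ofReal_mul (p := M * ‖y‖) (by positivity)]
  have hG2 : MemLp G 2 := ⟨hG1.aestronglyMeasurable, hGnorm.trans_lt ENNReal.ofReal_lt_top⟩
  have hinteg : ∫ ξ in B, Complex.exp (vline a ξ * t) •
      (S.generator.resolventOp (vline a ξ) ^ (k + 2)) y
      = ∫ ξ, S.generator.resolventOp (vline (ω + 1) ξ) (G ξ) := by
    rw [← integral_indicator hB]
    refine integral_congr_ae (Eventually.of_forall fun ξ => ?_)
    by_cases hξ : ξ ∈ B
    · simp only [hG, Set.indicator_of_mem hξ, hgR]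
    · simp only [hG, Set.indicator_of_notMem hξ, _root_.map_zero]
  rw [hinteg]
  have := (enorm_integral_resolventOp_vline_apply_le hS hρ hω hG1 hG2).trans
    (mul_le_mul_right hGnorm _)
  rw [he, ← ENNReal.ofReal_mul hM, ← ENNReal.ofReal_mul (by positivity),
    ← ofReal_norm, ENNReal.ofReal_le_ofReal_iff (by positivity)] at this
  refine this.trans_eq ?_
  ring

end C0Semigroup

/-! ### Shifting vertical lines -/

theorem intervalIntegral_vline {E : Type*} [NormedAddCommGroup E] [NormedSpace ℂ E] (F : ℂ → E)
    (a T : ℝ) : ∫ y in (2 * Real.pi * -T)..(2 * Real.pi * T), F (a + y * Complex.I)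
      = (2 * Real.pi : ℂ) • ∫ ξ in (-T)..T, F (vline a ξ) := by
  have := intervalIntegral.smul_integral_comp_mul_left (a := -T) (b := T)
    (fun y : ℝ => F (a + y * Complex.I)) (2 * Real.pi)
  rw [← this, ← Complex.coe_smul]
  simp [vline]

/-- Cauchy's theorem on rectangles: the truncated integrals of a holomorphic function which decays on
horizontal segments have the same limit on two vertical lines. -/
theorem tendsto_integral_vline_of_tendsto {E : Type*} [NormedAddCommGroup E] [NormedSpace ℂ E]
    [CompleteSpace E] {F : ℂ → E} {a b : ℝ} (hab : a ≤ b)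
    (hF : DifferentiableOn ℂ F {z | a ≤ z.re}) {δ : ℝ → ℝ} (hδ : Tendsto δ atTop (𝓝 0))
    (hdec : ∀ᶠ T in atTop, ∀ z : ℂ, a ≤ z.re → z.re ≤ b → |z.im| = T → ‖F z‖ ≤ δ T) {L : E}
    (hb : Tendsto (fun T : ℝ => ∫ ξ in (-T)..T, F (vline b ξ)) atTop (𝓝 L)) :
    Tendsto (fun T : ℝ => ∫ ξ in (-T)..T, F (vline a ξ)) atTop (𝓝 L) := by
  have hT2 : Tendsto (fun T : ℝ => 2 * Real.pi * T) atTop atTop :=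
    tendsto_id.const_mul_atTop (by positivity)
  have hdiff : Tendsto (fun T : ℝ => (∫ ξ in (-T)..T, F (vline b ξ)) -
      ∫ ξ in (-T)..T, F (vline a ξ)) atTop (𝓝 0) := by
    have hlim : Tendsto (fun T : ℝ => (2 * Real.pi)⁻¹ * (δ (2 * Real.pi * T) * |b - a| +
        δ (2 * Real.pi * T) * |b - a|)) atTop (𝓝 0) := by
      have h := (hδ.comp hT2).mul_const (|b - a|)
      simpa using (h.add h).const_mul (2 * Real.pi)⁻¹
    refine squeeze_zero_norm' ?_ hlim
    filter_upwards [hT2.eventually hdec, eventually_ge_atTop 0] with T hT hT0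
    have hrect := Complex.integral_boundary_rect_eq_zero_of_differentiableOn F
      (vline a (-T)) (vline b T) (hF.mono fun z hz => by
        have := hz.1
        simp only [Set.mem_preimage, vline_re, Set.uIcc_of_le hab] at this
        exact this.1)
    simp only [vline_re, vline_im] at hrect
    rw [intervalIntegral_vline, intervalIntegral_vline, smul_smul, smul_smul] at hrect
    have h1 : ∀ s : ℝ, |s| = 2 * Real.pi * T →
        ‖∫ x : ℝ in a..b, F (x + s * Complex.I)‖ ≤ δ (2 * Real.pi * T) * |b - a| := by
      intro s hs
      refine intervalIntegral.norm_integral_le_of_norm_le_const fun x hx => ?_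
      rw [Set.uIoc_of_le hab] at hx
      refine hT _ ?_ ?_ ?_
      · simpa using hx.1.le
      · simpa using hx.2
      · simpa using hs
    have habs : |2 * Real.pi * T| = 2 * Real.pi * T := abs_of_nonneg (by positivity)
    have h2 := h1 (2 * Real.pi * T) habs
    have h3 := h1 (2 * Real.pi * -T) (by rw [mul_neg, abs_neg, habs])
    have h4 : (Complex.I * (2 * Real.pi)) • ((∫ ξ in (-T)..T, F (vline b ξ)) -
        ∫ ξ in (-T)..T, F (vline a ξ))
        = (∫ x : ℝ in a..b, F (x + ((2 * Real.pi * T : ℝ) : ℂ) * Complex.I)) -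
          ∫ x : ℝ in a..b, F (x + ((2 * Real.pi * -T : ℝ) : ℂ) * Complex.I) := by
      rw [smul_sub, ← sub_eq_zero, ← hrect]
      abel
    have h5 := congrArg norm h4
    rw [norm_smul] at h5
    have h6 : ‖Complex.I * (2 * Real.pi : ℂ)‖ = 2 * Real.pi := by
      simp [abs_of_pos Real.pi_pos]
    rw [h6] at h5
    rw [inv_mul_eq_div, le_div_iff₀' (by positivity), h5]
    exact (norm_sub_le _ _).trans (add_le_add h2 h3)
  simpa using hb.sub hdiff

namespace IsPseudoResolventOn

variable {K : Type*} [NormedAddCommGroup K] [NormedSpace ℂ K] {R : ℂ → K →L[ℂ] K}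

theorem iteratedDeriv_vline (hR : IsPseudoResolventOn R {z : ℂ | 0 < z.re}) {b : ℝ} (hb : 0 < b)
    (x : K) (n : ℕ) : iteratedDeriv n (fun ξ => R (vline b ξ) x)
      = fun ξ => ((2 * Real.pi * Complex.I) ^ n * n.factorial) • (R (vline b ξ) ^ (n + 1)) x := by
  induction n with
  | zero => ext ξ; simp
  | succ n ih =>
    rw [iteratedDeriv_succ, ih]
    ext ξ
    have hpb : vline b ξ ∈ {z : ℂ | 0 < z.re} := by
      change 0 < (vline b ξ).re
      rwa [vline_re]
    have h1 := ((hR.hasDerivAt_pow isOpen_re_pos hpb n).clm_apply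
      (hasDerivAt_const (vline b ξ) x)).scomp ξ (hasDerivAt_vline b ξ)
    have h2 := h1.const_smul ((2 * Real.pi * Complex.I) ^ n * n.factorial)
    refine h2.deriv.trans ?_
    simp only [map_zero, add_zero, smul_apply, smul_smul]
    congr 1
    rw [Nat.factorial_succ]
    push_cast
    ring

/-- On the range of `R(b)²` the powers `R(z)^{k+2}` decay quadratically in `|Im z|`, since
`R(z) R(b) = (R(z) - R(b)) / (z - b)`. -/
theorem norm_pow_apply_sq_le (hR : IsPseudoResolventOn R {z : ℂ | 0 < z.re}) {N : ℝ} {z : ℂ}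
    (hz : 0 < z.re) (hN : ‖R z‖ ≤ N) {b : ℝ} (hb : 0 < b) (hzi : z.im ≠ 0) (k : ℕ) (v : K) :
    ‖(R z ^ (k + 2)) ((R b ^ 2) v)‖ ≤ N ^ k * ((N + ‖R b‖) / |z.im|) ^ 2 * ‖v‖ := by
  have hbU : (b : ℂ) ∈ {z : ℂ | 0 < z.re} := by
    change 0 < (b : ℂ).re
    simpa using hb
  have hN0 : 0 ≤ N := (norm_nonneg _).trans hN
  have him : |z.im| ≤ ‖z - b‖ := by simpa using Complex.abs_im_le_norm (z - b)
  have hpos : 0 < |z.im| := abs_pos.2 hzi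
  have h1 : ‖R z * R b‖ ≤ (N + ‖R b‖) / |z.im| := by
    rw [le_div_iff₀' hpos]
    calc |z.im| * ‖R z * R b‖ ≤ ‖z - b‖ * ‖R z * R b‖ := by gcongr
      _ = ‖R z - R b‖ := by rw [hR z hz b hbU, norm_smul]
      _ ≤ ‖R z‖ + ‖R b‖ := norm_sub_le _ _
      _ ≤ _ := by gcongr
  have h2 : (R z ^ (k + 2)) ((R b ^ 2) v) = (R z ^ k * (R z * R b) ^ 2) v := by
    rw [(hR.commute hz hbU).mul_pow, ← mul_assoc, ← pow_add]
    rfl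
  rw [h2]
  refine ContinuousLinearMap.le_of_opNorm_le _ ?_ _
  refine (norm_mul_le _ _).trans (mul_le_mul ?_ ?_ (norm_nonneg _) (by positivity))
  · exact (ContinuousLinearMap.opNorm_pow_le _ k).trans (by gcongr)
  · exact (ContinuousLinearMap.opNorm_pow_le _ 2).trans (by gcongr)

end IsPseudoResolventOn

/-! ### Fourier inversion for powers of the resolvent -/

namespace C0Semigroup

variable {K : Type*} [NormedAddCommGroup K] [NormedSpace ℂ K] [CompleteSpace K]
  {S : C0Semigroup K} {M ω : ℝ}

/-- The Fourier transform of `tⁿ e^{-(ω+1)t} S(t) x`, by differentiating that of the damped orbit `n`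
times in the frequency. -/
theorem fourier_pow_smul_dampedOrbit (hS : ∀ t, 0 ≤ t → ‖S t‖ ≤ M * Real.exp (ω * t))
    (hρ : {z : ℂ | 0 < z.re} ⊆ S.generator.rho) (hω : 0 ≤ ω) (x : K) (n : ℕ) (ξ : ℝ) :
    𝓕 (fun t : ℝ => t ^ n • S.dampedOrbit (ω + 1) x t) ξ
      = ((-1) ^ (n + 1) * n.factorial : ℂ) •
        (S.generator.resolventOp (vline (ω + 1) ξ) ^ (n + 1)) x := by
  have hR := LinearPMap.isPseudoResolventOn_resolventOp hρ
  have h1 := congrFun (Real.iteratedDeriv_fourier (N := ⊤) (n := n)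
    (fun k _ => integrable_pow_smul_dampedOrbit hS x k) le_top) ξ
  have h2 : 𝓕 (S.dampedOrbit (ω + 1) x)
      = -fun ξ => S.generator.resolventOp (vline (ω + 1) ξ) x := by
    ext ξ
    rw [fourier_dampedOrbit hS hρ hω]
    rfl
  have h3 : (fun t : ℝ => (-2 * Real.pi * Complex.I * t) ^ n • S.dampedOrbit (ω + 1) x t)
      = ((-2 * Real.pi * Complex.I) ^ n : ℂ) • fun t : ℝ => t ^ n • S.dampedOrbit (ω + 1) x t := by
    ext t
    simp only [Pi.smul_apply]
    rw [mul_pow, mul_smul, ← Complex.ofReal_pow, Complex.coe_smul]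
  have h4 : 𝓕 (((-2 * Real.pi * Complex.I) ^ n : ℂ) •
      fun t : ℝ => t ^ n • S.dampedOrbit (ω + 1) x t) ξ
      = ((-2 * Real.pi * Complex.I) ^ n : ℂ) •
        𝓕 (fun t : ℝ => t ^ n • S.dampedOrbit (ω + 1) x t) ξ := by
    rw [Real.fourier_real_eq_integral_exp_smul, Real.fourier_real_eq_integral_exp_smul,
      ← integral_smul]
    refine integral_congr_ae (Eventually.of_forall fun s => ?_)
    exact smul_comm _ _ _
  rw [h2, iteratedDeriv_neg, hR.iteratedDeriv_vline (by positivity), h3, h4] at h1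
  have hne : ((-2 * Real.pi * Complex.I) ^ n : ℂ) ≠ 0 :=
    pow_ne_zero _ (by simp [Real.pi_ne_zero])
  refine smul_right_injective K hne ?_
  simp only
  rw [← h1, smul_smul, ← neg_smul]
  congr 1
  have hpow : (-2 * Real.pi * Complex.I : ℂ) ^ n = (-1) ^ n * (2 * Real.pi * Complex.I) ^ n := by
    rw [← mul_pow]
    ring_nf
  rw [hpow, pow_succ]
  have h5 : ((-1 : ℂ) ^ n) * (-1) ^ n = 1 := by rw [← mul_pow]; simp
  linear_combination (2 * Real.pi * Complex.I : ℂ) ^ n * n.factorial * h5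

/-- Inverse Laplace transform of a power of the resolvent, when its integrand is integrable. -/
theorem pow_smul_eq_integral_vline (hS : ∀ t, 0 ≤ t → ‖S t‖ ≤ M * Real.exp (ω * t))
    (hρ : {z : ℂ | 0 < z.re} ⊆ S.generator.rho) (hω : 0 ≤ ω) (x : K) (n : ℕ)
    (hinteg : Integrable fun ξ => (S.generator.resolventOp (vline (ω + 1) ξ) ^ (n + 1)) x)
    {t : ℝ} (ht : 0 < t) :
    t ^ n • S t x = ((-1) ^ (n + 1) * n.factorial : ℂ) • ∫ ξ, Complex.exp (vline (ω + 1) ξ * t) •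
      (S.generator.resolventOp (vline (ω + 1) ξ) ^ (n + 1)) x := by
  set f : ℝ → K := fun t : ℝ => t ^ n • S.dampedOrbit (ω + 1) x t with hf
  have hFf : 𝓕 f = fun ξ => ((-1) ^ (n + 1) * n.factorial : ℂ) •
      (S.generator.resolventOp (vline (ω + 1) ξ) ^ (n + 1)) x :=
    funext fun ξ => fourier_pow_smul_dampedOrbit hS hρ hω x n ξ
  have hcont : ContinuousAt f t := by
    have hc : Continuous fun t : ℝ =>
        t ^ n • Complex.exp (-((ω + 1 : ℝ) : ℂ) * t) • S (max t 0) x :=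
      (by fun_prop : Continuous fun t : ℝ => t ^ n).smul (S.continuous_exp_smul_orbit _ x)
    refine hc.continuousAt.congr ?_
    filter_upwards [lt_mem_nhds ht] with s hs
    rw [hf]
    simp only
    rw [dampedOrbit_of_pos _ _ hs, max_eq_left hs.le]
  have hinv : 𝓕⁻ (𝓕 f) t = f t := (integrable_pow_smul_dampedOrbit hS x n).fourierInv_fourier_eq
    (by rw [← hf, hFf]; exact hinteg.smul _) hcont
  rw [hFf, Real.fourierInv_eq'] at hinv
  have hft : f t = Complex.exp (-((ω + 1 : ℝ) : ℂ) * t) • t ^ n • S t x := by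
    rw [hf]
    simp only
    rw [dampedOrbit_of_pos _ _ ht, smul_comm]
  have h1 : t ^ n • S t x = Complex.exp (((ω + 1 : ℝ) : ℂ) * t) • f t := by
    rw [hft, smul_smul, ← Complex.exp_add, neg_mul, add_neg_cancel, Complex.exp_zero, one_smul]
  rw [h1, ← hinv, ← integral_smul, ← integral_smul]
  refine integral_congr_ae (Eventually.of_forall fun ξ => ?_)
  simp only [smul_smul]
  congr 1
  rw [← mul_assoc, ← Complex.exp_add, mul_comm]
  congr 2
  simp [vline]
  ring

end C0Semigroup

/-! ### Approximation by the low-frequency integral -/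

namespace IsPseudoResolventOn

variable {K : Type*} [NormedAddCommGroup K] [NormedSpace ℂ K] {R : ℂ → K →L[ℂ] K}

theorem integrable_vline_pow_apply_sq [CompleteSpace K]
    (hR : IsPseudoResolventOn R {z : ℂ | 0 < z.re}) {N τ : ℝ}
    (hN : ∀ z : ℂ, 0 < z.re → τ ≤ ‖z‖ → ‖R z‖ ≤ N) {b : ℝ} (hb : 0 < b) (k : ℕ) (v : K) :
    Integrable fun ξ => (R (vline b ξ) ^ (k + 2)) ((R b ^ 2) v) := by
  have hc : Continuous fun ξ => (R (vline b ξ) ^ (k + 2)) ((R b ^ 2) v) :=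
    ((hR.continuous_vline hb).pow (k + 2)).clm_apply continuous_const
  refine hc.locallyIntegrable.integrable_of_isBigO_cocompact
    (g := fun ξ : ℝ => (1 + ξ ^ 2)⁻¹) ?_ (integrable_inv_one_add_sq.integrableAtFilter _)
  refine Asymptotics.IsBigO.of_bound (N ^ k * (N + ‖R b‖) ^ 2 * ‖v‖) ?_
  filter_upwards [tendsto_norm_cocompact_atTop.eventually_ge_atTop (max τ 1)] with ξ hξ
  rw [Real.norm_eq_abs] at hξ
  have hξ1 : 1 ≤ |ξ| := (le_max_right _ _).trans hξ
  have hpi : |ξ| ≤ |2 * Real.pi * ξ| := by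
    rw [abs_mul, abs_of_pos Real.two_pi_pos]
    nlinarith [Real.pi_gt_three]
  have hbre : 0 < (vline b ξ).re := by rwa [vline_re]
  have hNz : ‖R (vline b ξ)‖ ≤ N :=
    hN _ hbre (((le_max_left _ _).trans hξ).trans (hpi.trans (abs_le_norm_vline b ξ)))
  have hN0 : 0 ≤ N := (norm_nonneg _).trans hNz
  have him : (vline b ξ).im ≠ 0 := by
    rw [vline_im, ← abs_pos]
    linarith
  refine (hR.norm_pow_apply_sq_le hbre hNz hb him k v).trans ?_
  have hsq : 1 + ξ ^ 2 ≤ |(vline b ξ).im| ^ 2 := by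
    have h2 : 2 * |ξ| ≤ |2 * Real.pi * ξ| := by
      rw [abs_mul, abs_of_pos Real.two_pi_pos]
      nlinarith [Real.pi_gt_three]
    rw [vline_im]
    nlinarith [sq_abs ξ]
  rw [div_pow, Real.norm_of_nonneg (by positivity)]
  calc N ^ k * ((N + ‖R b‖) ^ 2 / |(vline b ξ).im| ^ 2) * ‖v‖
      ≤ N ^ k * ((N + ‖R b‖) ^ 2 / (1 + ξ ^ 2)) * ‖v‖ := by gcongr
    _ = _ := by ring

theorem tendsto_integral_vline_shift [CompleteSpace K]
    (hR : IsPseudoResolventOn R {z : ℂ | 0 < z.re}) {N τ : ℝ}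
    (hN : ∀ z : ℂ, 0 < z.re → τ ≤ ‖z‖ → ‖R z‖ ≤ N) {a b : ℝ} (ha : 0 < a) (hab : a ≤ b)
    (k : ℕ) (v : K) {t : ℝ} (ht : 0 ≤ t) :
    Tendsto (fun T : ℝ => ∫ ξ in (-T)..T,
        Complex.exp (vline a ξ * t) • (R (vline a ξ) ^ (k + 2)) ((R b ^ 2) v)) atTop
      (𝓝 (∫ ξ, Complex.exp (vline b ξ * t) • (R (vline b ξ) ^ (k + 2)) ((R b ^ 2) v))) := by
  have hb : 0 < b := ha.trans_le hab
  have hinteg : Integrable fun ξ =>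
      Complex.exp (vline b ξ * t) • (R (vline b ξ) ^ (k + 2)) ((R b ^ 2) v) := by
    refine (hR.integrable_vline_pow_apply_sq hN hb k v).bdd_smul (Real.exp (b * t))
      (Continuous.aestronglyMeasurable ?_)
      (Eventually.of_forall fun ξ => (norm_cexp_vline_mul b ξ t).le)
    exact Complex.continuous_exp.comp ((_root_.continuous_vline b).mul continuous_const)
  refine tendsto_integral_vline_of_tendsto
    (F := fun z => Complex.exp (z * t) • (R z ^ (k + 2)) ((R b ^ 2) v)) hab ?_
    (δ := fun T => Real.exp (b * t) * (N ^ k * ((N + ‖R b‖) / T) ^ 2 * ‖v‖)) ?_ ?_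
    (intervalIntegral_tendsto_integral hinteg tendsto_neg_atTop_atBot tendsto_id)
  · intro z hz
    have hz' : z ∈ {z : ℂ | 0 < z.re} := ha.trans_le hz
    have h1 := (hR.hasDerivAt_pow isOpen_re_pos hz' (k + 1)).clm_apply
      (hasDerivAt_const z ((R b ^ 2) v))
    have h2 : DifferentiableAt ℂ (fun z : ℂ => Complex.exp (z * t)) z := by fun_prop
    exact (h2.smul h1.differentiableAt).differentiableWithinAt
  · have h : Tendsto (fun T : ℝ => (N + ‖R b‖) / T) atTop (𝓝 0) :=
      tendsto_const_nhds.div_atTop tendsto_id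
    simpa using (((h.pow 2).const_mul (N ^ k)).mul_const ‖v‖).const_mul (Real.exp (b * t))
  · filter_upwards [eventually_ge_atTop τ, eventually_gt_atTop 0] with T hTτ hT0 z hza hzb hzT
    have hzre : 0 < z.re := ha.trans_le hza
    have him : z.im ≠ 0 := by
      rw [← abs_pos, hzT]; exact hT0
    have hNz := hN z hzre (hTτ.trans (hzT ▸ Complex.abs_im_le_norm z))
    have h1 := hR.norm_pow_apply_sq_le hzre hNz hb him k v
    rw [hzT] at h1
    rw [norm_smul, Complex.norm_exp]
    refine mul_le_mul ?_ h1 (norm_nonneg _) (Real.exp_pos _).le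
    refine Real.exp_le_exp.2 ?_
    simpa using mul_le_mul_of_nonneg_right hzb ht

end IsPseudoResolventOn

namespace C0Semigroup

variable {K : Type*} [NormedAddCommGroup K] [InnerProductSpace ℂ K] [CompleteSpace K]
  {S : C0Semigroup K} {M ω : ℝ}

/-- Up to an error bounded by `C e^{at} ‖y‖`, uniformly in the line `Re z = a`, the vector
`t^{k+1} S(t) y` is the integral of `e^{zt} R(z)^{k+2} y` over low frequencies. For `y` in the range
of `R(ω + 1)²` this is the shifted inversion formula and the high-frequency estimate; both sides are
continuous in `y` and this range is dense. -/
theorem exists_norm_pow_smul_sub_integral_le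
    (hM : 0 ≤ M) (hS : ∀ t, 0 ≤ t → ‖S t‖ ≤ M * Real.exp (ω * t))
    (hρ : {z : ℂ | 0 < z.re} ⊆ S.generator.rho) (hω : 0 ≤ ω) {N τ : ℝ} (hN0 : 0 ≤ N)
    (hN : ∀ z : ℂ, 0 < z.re → τ ≤ ‖z‖ → ‖S.generator.resolventOp z‖ ≤ N) (k : ℕ)
    {β : ℝ} (hβ0 : 0 ≤ β) (hβ : τ ≤ 2 * Real.pi * β) :
    ∃ C : ℝ, 0 ≤ C ∧ ∀ a t : ℝ, 0 < a → a ≤ ω + 1 → 0 < t → ∀ y : K,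
      ‖t ^ (k + 1) • S t y - ((-1) ^ (k + 2) * (k + 1).factorial : ℂ) •
        (∫ ξ in (-β)..β, Complex.exp (vline a ξ * t) •
          S.generator.resolventOp (vline a ξ) ^ (k + 2)) y‖ ≤ C * Real.exp (a * t) * ‖y‖ := by
  have hR := LinearPMap.isPseudoResolventOn_resolventOp hρ
  obtain ⟨C, hC0, hC⟩ := exists_norm_setIntegral_resolventOp_pow_le hM hS hρ hω hN0 hN k
  refine ⟨(k + 1).factorial * C, by positivity, fun a t ha haω ht y => ?_⟩
  have hcont : Continuous fun ξ => Complex.exp (vline a ξ * t) •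
      S.generator.resolventOp (vline a ξ) ^ (k + 2) :=
    (Complex.continuous_exp.comp ((continuous_vline a).mul continuous_const)).smul
      ((hR.continuous_vline ha).pow (k + 2))
  have hμ : 0 < ω + 1 := by positivity
  have hμρ : ((ω + 1 : ℝ) : ℂ) ∈ S.generator.rho :=
    hρ (by change 0 < ((ω + 1 : ℝ) : ℂ).re; simpa using hμ)
  have hdense : DenseRange (S.generator.resolventOp ((ω + 1 : ℝ) : ℂ) ^ 2 : K →L[ℂ] K) := by
    rw [sq]
    exact (denseRange_resolventOp hμρ).comp (denseRange_resolventOp hμρ)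
      (ContinuousLinearMap.continuous _)
  set J : K →L[ℂ] K := ∫ ξ in (-β)..β, Complex.exp (vline a ξ * t) •
    S.generator.resolventOp (vline a ξ) ^ (k + 2) with hJ
  have hclosed : IsClosed {y : K | ‖t ^ (k + 1) • S t y -
      ((-1) ^ (k + 2) * (k + 1).factorial : ℂ) • J y‖ ≤
        (k + 1).factorial * C * Real.exp (a * t) * ‖y‖} :=
    isClosed_le (by fun_prop) (by fun_prop)
  refine hdense.induction_on (p := fun y => ‖t ^ (k + 1) • S t y -
      ((-1) ^ (k + 2) * (k + 1).factorial : ℂ) • J y‖ ≤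
        (k + 1).factorial * C * Real.exp (a * t) * ‖y‖) y hclosed fun v => ?_
  set x := (S.generator.resolventOp ((ω + 1 : ℝ) : ℂ) ^ 2 : K →L[ℂ] K) v
  rw [hJ, ContinuousLinearMap.intervalIntegral_apply (hcont.intervalIntegrable _ _)]
  simp only [smul_apply]
  have hrep := pow_smul_eq_integral_vline hS hρ hω x (k + 1)
    (hR.integrable_vline_pow_apply_sq hN hμ k v) ht
  rw [hrep, ← smul_sub, norm_smul]
  have hcoef : ‖((-1) ^ (k + 2) * (k + 1).factorial : ℂ)‖ = (k + 1).factorial := by simp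
  rw [hcoef, mul_assoc, mul_assoc]
  refine mul_le_mul_of_nonneg_left ?_ (by positivity)
  rw [← mul_assoc]
  have hlim := (hR.tendsto_integral_vline_shift hN ha haω k v ht.le).sub_const
    (∫ ξ in (-β)..β, Complex.exp (vline a ξ * t) •
      (S.generator.resolventOp (vline a ξ) ^ (k + 2)) x)
  -- The truncated integral minus its low-frequency part is a high-frequency integral.
  refine le_of_tendsto hlim.norm ?_
  filter_upwards [eventually_ge_atTop β] with T hT
  have hcx : Continuous fun ξ => Complex.exp (vline a ξ * t) •
      (S.generator.resolventOp (vline a ξ) ^ (k + 2)) x := hcont.clm_apply continuous_const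
  have hsub : Set.Ioc (-β) β ⊆ Set.Ioc (-T) T := Set.Ioc_subset_Ioc (by linarith) hT
  have h := hC a t ha haω (Set.Ioc (-T) T \ Set.Ioc (-β) β)
    (measurableSet_Ioc.diff measurableSet_Ioc)
    ((Metric.isBounded_Ioc _ _).subset Set.sdiff_subset) (fun ξ hξ => by
      rw [abs_mul, abs_of_pos Real.two_pi_pos]
      refine hβ.trans (mul_le_mul_of_nonneg_left ?_ Real.two_pi_pos.le)
      by_contra! hlt
      rw [abs_lt] at hlt
      exact hξ.2 ⟨hlt.1, hlt.2.le⟩) x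
  rw [setIntegral_sdiff measurableSet_Ioc (hcx.integrableOn_Ioc) hsub] at h
  rw [intervalIntegral.integral_of_le (by linarith), intervalIntegral.integral_of_le (by linarith)]
  exact h

end C0Semigroup

/-! ### The low-frequency estimate -/

/-- The low-frequency estimate: on the line `Re z = 1 / t` the substitution `u = tξ` bounds the
integral of `‖z‖ ^ p` by a multiple of `t ^ (-p - 1)`. -/
theorem norm_integral_le_of_norm_le_vline_rpow {Y : Type*} [NormedAddCommGroup Y]
    [NormedSpace ℝ Y] {H : ℝ → Y} {β t p c₁ c₂ : ℝ} (hβ : 0 ≤ β) (ht : 0 < t) (hp : p < -1)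
    (hc₁ : 0 ≤ c₁) (hH : ∀ ξ ∈ Set.Ioc (-β) β, ‖H ξ‖ ≤ c₁ * ‖vline t⁻¹ ξ‖ ^ p + c₂) :
    ‖∫ ξ in (-β)..β, H ξ‖
      ≤ c₁ * (∫ u : ℝ, (1 + ‖u‖ ^ 2) ^ (p / 2)) * t ^ (-p - 1) + c₂ * (2 * β) := by
  set φ : ℝ → ℝ := fun u => (1 + ‖u‖ ^ 2) ^ (p / 2) with hφ
  have hφi : Integrable φ := by
    have := integrable_rpow_neg_one_add_norm_sq (E := ℝ) (μ := volume) (r := -p)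
      (by simp; linarith)
    simpa [hφ] using this
  have hφt : Integrable fun ξ => φ (t * ξ) := hφi.comp_mul_left' ht.ne'
  have hle : ∀ ξ : ℝ, ‖vline t⁻¹ ξ‖ ^ p ≤ t ^ (-p) * φ (t * ξ) := by
    intro ξ
    have h0 : 0 < 1 + ‖t * ξ‖ ^ 2 := by positivity
    -- `‖vline t⁻¹ ξ‖² = t⁻² + (2πξ)² ≥ t⁻² (1 + (tξ)²)`
    have h1 : t⁻¹ * Real.sqrt (1 + ‖t * ξ‖ ^ 2) ≤ ‖vline t⁻¹ ξ‖ := by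
      rw [Complex.norm_eq_sqrt_sq_add_sq, vline_re, vline_im]
      refine Real.le_sqrt_of_sq_le ?_
      rw [mul_pow, Real.sq_sqrt h0.le, Real.norm_eq_abs, sq_abs, mul_add, mul_one, mul_pow,
        ← mul_assoc, ← mul_pow, inv_mul_cancel₀ ht.ne', one_pow, one_mul]
      have : 1 ≤ (2 * Real.pi) ^ 2 := by nlinarith [Real.pi_gt_three]
      nlinarith [sq_nonneg ξ]
    calc ‖vline t⁻¹ ξ‖ ^ p ≤ (t⁻¹ * Real.sqrt (1 + ‖t * ξ‖ ^ 2)) ^ p :=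
          Real.rpow_le_rpow_of_nonpos (by positivity) h1 (by linarith)
      _ = _ := by
        rw [Real.mul_rpow (by positivity) (Real.sqrt_nonneg _), Real.inv_rpow ht.le,
          ← Real.rpow_neg ht.le, Real.sqrt_eq_rpow, ← Real.rpow_mul h0.le, hφ]
        congr 2
        ring
  have hg : IntervalIntegrable (fun ξ => c₁ * (t ^ (-p) * φ (t * ξ)) + c₂) volume (-β) β :=
    (((hφt.const_mul _).const_mul _).intervalIntegrable).add intervalIntegrable_const
  have hββ : -β ≤ β := by linarith
  refine (intervalIntegral.norm_integral_le_of_norm_le hββ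
    (Eventually.of_forall fun ξ hξ => (hH ξ hξ).trans
      (add_le_add_left (mul_le_mul_of_nonneg_left (hle ξ) hc₁) _)) hg).trans ?_
  rw [intervalIntegral.integral_add (((hφt.const_mul _).const_mul _).intervalIntegrable)
    intervalIntegrable_const, intervalIntegral.integral_const_mul,
    intervalIntegral.integral_const_mul, intervalIntegral.integral_const]
  have hmono : ∫ ξ in (-β)..β, φ (t * ξ) ≤ ∫ ξ, φ (t * ξ) := by
    rw [intervalIntegral.integral_of_le hββ]
    exact setIntegral_le_integral hφt (Eventually.of_forall fun ξ => by
      change (0 : ℝ) ≤ (1 + ‖t * ξ‖ ^ 2) ^ (p / 2)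
      positivity)
  rw [Measure.integral_comp_mul_left φ t, abs_of_pos (inv_pos.2 ht), smul_eq_mul] at hmono
  refine add_le_add ?_ (le_of_eq ?_)
  · rw [mul_assoc]
    refine mul_le_mul_of_nonneg_left ?_ hc₁
    refine (mul_le_mul_of_nonneg_left hmono (by positivity)).trans_eq ?_
    rw [Real.rpow_sub_one ht.ne']
    ring
  · rw [smul_eq_mul]; ring

namespace C0Semigroup

variable {K : Type*} [NormedAddCommGroup K] [InnerProductSpace ℂ K] [CompleteSpace K]
  {S : C0Semigroup K} {M ω : ℝ}

/-- The decay estimate multiplied by `t^{k+1}`, from the choice `a = 1 / t` of the line, for which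
`e^{at}` is constant. -/
theorem exists_pow_mul_norm_le {X Y : Type*} [NormedAddCommGroup X] [NormedSpace ℂ X]
    [NormedAddCommGroup Y] [NormedSpace ℂ Y] [CompleteSpace Y] (TX : X →L[ℂ] K) (TY : K →L[ℂ] Y)
    (hM : 0 ≤ M) (hS : ∀ t, 0 ≤ t → ‖S t‖ ≤ M * Real.exp (ω * t))
    (hρ : {z : ℂ | 0 < z.re} ⊆ S.generator.rho) (hω : 0 ≤ ω) {N τ : ℝ} (hN0 : 0 ≤ N)
    (hτ : 0 ≤ τ) (hN : ∀ z : ℂ, 0 < z.re → τ ≤ ‖z‖ → ‖S.generator.resolventOp z‖ ≤ N) (k : ℕ)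
    {C₀ p : ℝ} (hC₀ : 0 ≤ C₀) (hp : p < -1)
    (hlow : ∀ z : ℂ, 0 < z.re → ‖z‖ < τ →
      ‖TY ∘L (S.generator.resolventOp z ^ (k + 2) : K →L[ℂ] K) ∘L TX‖ ≤ C₀ * ‖z‖ ^ p) :
    ∃ D : ℝ, 0 ≤ D ∧ ∀ t : ℝ, 1 ≤ t → t ^ (k + 1) * ‖TY ∘L S t ∘L TX‖ ≤ D * t ^ (-p - 1) := by
  have hR := LinearPMap.isPseudoResolventOn_resolventOp hρ
  set β := τ / (2 * Real.pi) with hβ_def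
  have hβ0 : 0 ≤ β := by positivity
  have hβ : τ ≤ 2 * Real.pi * β := by
    rw [hβ_def, mul_div_cancel₀ _ Real.two_pi_pos.ne']
  obtain ⟨C, hC0, hC⟩ := exists_norm_pow_smul_sub_integral_le hM hS hρ hω hN0 hN k hβ0 hβ
  set c := N ^ (k + 2) * ‖TY‖ * ‖TX‖
  have hc : 0 ≤ c := by positivity
  set I := ∫ u : ℝ, (1 + ‖u‖ ^ 2) ^ (p / 2)
  have hI : 0 ≤ I := integral_nonneg fun u => by positivity
  set D₁ := ‖TY‖ * (C * Real.exp 1 * ‖TX‖) + (k + 1).factorial * (Real.exp 1 * c * (2 * β))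
  set D₂ := (k + 1).factorial * (Real.exp 1 * C₀ * I)
  have hD₁ : 0 ≤ D₁ := by positivity
  have hD₂ : 0 ≤ D₂ := by positivity
  refine ⟨D₁ + D₂, by positivity, fun t ht => ?_⟩
  have ht0 : 0 < t := by linarith
  have hat : t⁻¹ * t = 1 := inv_mul_cancel₀ ht0.ne'
  have hone : 1 ≤ t ^ (-p - 1) := Real.one_le_rpow ht (by linarith)
  have hbound : ∀ ξ, ‖TY ∘L (S.generator.resolventOp (vline t⁻¹ ξ) ^ (k + 2) : K →L[ℂ] K) ∘L TX‖
      ≤ C₀ * ‖vline t⁻¹ ξ‖ ^ p + c := by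
    intro ξ
    have hre : 0 < (vline t⁻¹ ξ).re := by rw [vline_re]; positivity
    rcases lt_or_ge ‖vline t⁻¹ ξ‖ τ with h | h
    · exact (hlow _ hre h).trans (le_add_of_nonneg_right hc)
    -- Points of the line with small frequency may lie outside the disc of radius `τ`; there the
    -- resolvent is bounded.
    · refine le_trans ?_ (le_add_of_nonneg_left (by positivity))
      refine (ContinuousLinearMap.opNorm_comp_le _ _).trans ?_
      rw [show c = ‖TY‖ * (N ^ (k + 2) * ‖TX‖) by ring]
      gcongr
      refine (ContinuousLinearMap.opNorm_comp_le _ _).trans ?_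
      gcongr
      exact (ContinuousLinearMap.opNorm_pow_le _ _).trans (by gcongr; exact hN _ hre h)
  set J : K →L[ℂ] K := ∫ ξ in (-β)..β, Complex.exp (vline t⁻¹ ξ * t) •
    S.generator.resolventOp (vline t⁻¹ ξ) ^ (k + 2) with hJ
  have hcont : Continuous fun ξ => Complex.exp (vline t⁻¹ ξ * t) •
      S.generator.resolventOp (vline t⁻¹ ξ) ^ (k + 2) :=
    (Complex.continuous_exp.comp ((continuous_vline _).mul continuous_const)).smul
      ((hR.continuous_vline (inv_pos.2 ht0)).pow (k + 2))
  have hJle : ∀ x, ‖TY (J (TX x))‖ ≤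
      (Real.exp 1 * C₀ * I * t ^ (-p - 1) + Real.exp 1 * c * (2 * β)) * ‖x‖ := by
    intro x
    rw [hJ, ContinuousLinearMap.intervalIntegral_apply (hcont.intervalIntegrable _ _),
      ← ContinuousLinearMap.intervalIntegral_comp_comm _
        ((hcont.clm_apply continuous_const).intervalIntegrable _ _)]
    refine (norm_integral_le_of_norm_le_vline_rpow (c₁ := Real.exp 1 * C₀ * ‖x‖)
      (c₂ := Real.exp 1 * c * ‖x‖) hβ0 ht0 hp (by positivity) fun ξ _ => ?_).trans_eq (by ring)
    rw [smul_apply, map_smul, norm_smul, norm_cexp_vline_mul, hat]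
    have := ContinuousLinearMap.le_of_opNorm_le _ (hbound ξ) x
    calc _ ≤ Real.exp 1 * ((C₀ * ‖vline t⁻¹ ξ‖ ^ p + c) * ‖x‖) :=
          mul_le_mul_of_nonneg_left this (Real.exp_pos 1).le
      _ = _ := by ring
  have hfin : ‖((t ^ (k + 1) : ℝ) : ℂ) • (TY ∘L S t ∘L TX)‖ ≤ (D₁ + D₂) * t ^ (-p - 1) := by
    refine ContinuousLinearMap.opNorm_le_bound _ (by positivity) fun x => ?_
    have h1 := hC t⁻¹ t (inv_pos.2 ht0) ((inv_le_one_of_one_le₀ ht).trans (by linarith)) ht0 (TX x)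
    rw [hat] at h1
    have h2 : (((t ^ (k + 1) : ℝ) : ℂ) • (TY ∘L S t ∘L TX)) x
        = TY (t ^ (k + 1) • S t (TX x) - ((-1) ^ (k + 2) * (k + 1).factorial : ℂ) • J (TX x))
          + ((-1) ^ (k + 2) * (k + 1).factorial : ℂ) • TY (J (TX x)) := by
      rw [← TY.map_smul, ← _root_.map_add, sub_add_cancel, ← Complex.coe_smul, TY.map_smul]
      rfl
    have hcoef : ‖((-1) ^ (k + 2) * (k + 1).factorial : ℂ)‖ = (k + 1).factorial := by simp
    rw [h2]
    calc _ ≤ ‖TY‖ * (C * Real.exp 1 * (‖TX‖ * ‖x‖)) + (k + 1).factorial *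
          ((Real.exp 1 * C₀ * I * t ^ (-p - 1) + Real.exp 1 * c * (2 * β)) * ‖x‖) := by
          refine (norm_add_le _ _).trans (add_le_add ?_ ?_)
          · refine (TY.le_opNorm _).trans ?_
            gcongr
            exact h1.trans (by gcongr; exact TX.le_opNorm x)
          · rw [norm_smul, hcoef]
            gcongr
            exact hJle x
      _ = (D₁ + D₂ * t ^ (-p - 1)) * ‖x‖ := by ring
      _ ≤ (D₁ * t ^ (-p - 1) + D₂ * t ^ (-p - 1)) * ‖x‖ := by
          gcongr
          exact le_mul_of_one_le_right hD₁ hone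
      _ = _ := by ring
  rwa [norm_smul, Complex.norm_of_nonneg (by positivity)] at hfin

end C0Semigroup

/-! ### The decay estimate -/

theorem mainTheorem5
    {K : Type*} [NormedAddCommGroup K] [InnerProductSpace ℂ K] [CompleteSpace K]
    {X : Type*} [NormedAddCommGroup X] [NormedSpace ℂ X]
    {Y : Type*} [NormedAddCommGroup Y] [NormedSpace ℂ Y]
    (S : C0Semigroup K) (A : K →ₗ.[ℂ] K) (hA : A = S.generator)
    (TX : X →L[ℂ] K) (TY : K →L[ℂ] Y)
    (τ₀ : ℝ) (hτ₀ : 1 ≤ τ₀)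
    (hrho : {z : ℂ | 0 ≤ z.re} \ {z : ℂ | ∃ s ∈ Set.Ioo (-τ₀) τ₀, z = Complex.I * (s : ℂ)} ⊆ A.rho)
    (hhigh : ∃ M : ℝ, ∀ z ∈ closure ({z : ℂ | 0 < z.re} \ Metric.ball (0 : ℂ) τ₀),
      ‖A.resolventOp z‖ ≤ M)
    (m : ℕ) (κ : ℝ) (hκ : κ ∈ Set.Ico (0 : ℝ) 1) (C₀ : ℝ) (hC₀ : 0 < C₀)
    (hlow : ∀ j ∈ (if κ = 0 then {m, m + 1, m + 2} else {m, m + 1} : Set ℕ),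
      ∀ z ∈ Metric.ball (0 : ℂ) τ₀ ∩ {z : ℂ | 0 < z.re},
        ‖TY ∘L ((A.resolventOp z) ^ (1 + j) : K →L[ℂ] K) ∘L TX‖ ≤ C₀ * ‖z‖ ^ ((m : ℝ) - κ - (j : ℝ))) :
    ∃ C : ℝ, 0 < C ∧ ∀ t : ℝ, 0 ≤ t →
      ‖TY ∘L S t ∘L TX‖ ≤ C * (Real.sqrt (1 + t ^ 2)) ^ (-(m : ℝ) - 1 + κ) := by
  subst hA
  have hρ : {z : ℂ | 0 < z.re} ⊆ S.generator.rho := fun z hz => hrho ⟨show 0 ≤ z.re from le_of_lt (show 0 < z.re from hz), by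
    rintro ⟨s, -, rfl⟩
    simp at hz⟩
  obtain ⟨N, hN⟩ := hhigh
  have hN' : ∀ z : ℂ, 0 < z.re → τ₀ ≤ ‖z‖ → ‖S.generator.resolventOp z‖ ≤ max N 0 :=
    fun z hz hzτ => (hN z (subset_closure ⟨hz, by simpa using hzτ⟩)).trans (le_max_left _ _)
  obtain ⟨M, ω, hM1, hω, hS⟩ := S.exists_norm_le_exp
  have hM0 : 0 ≤ M := by linarith
  -- The exponent of the resolvent power is chosen so that `‖z‖ ^ p` is integrable at infinity on
  -- vertical lines; for `κ = 0` this requires the additional power `j = m + 2`.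
  obtain ⟨k, hkp, hklow⟩ : ∃ k : ℕ, (m : ℝ) - κ - ((k + 1 : ℕ) : ℝ) < -1 ∧
      k + 1 ∈ (if κ = 0 then {m, m + 1, m + 2} else {m, m + 1} : Set ℕ) := by
    by_cases h : κ = 0
    · refine ⟨m + 1, ?_, by simp [h]⟩
      rw [h]; push_cast; linarith
    · refine ⟨m, ?_, by simp [h]⟩
      have : 0 < κ := lt_of_le_of_ne hκ.1 (Ne.symm h)
      push_cast; linarith
  -- Bochner integrals need a complete target space.
  let ι : Y →ₗᵢ[ℂ] UniformSpace.Completion Y := UniformSpace.Completion.toComplₗᵢ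
  have hι : ∀ T : X →L[ℂ] Y, ‖ι.toContinuousLinearMap ∘L T‖ = ‖T‖ := fun T =>
    ι.norm_toContinuousLinearMap_comp
  obtain ⟨D, hD0, hD⟩ := C0Semigroup.exists_pow_mul_norm_le TX (ι.toContinuousLinearMap ∘L TY)
    hM0 hS hρ hω (le_max_right N 0) (by linarith) hN' k hC₀.le hkp (fun z hz hzτ => by
      have := hlow (k + 1) hklow z ⟨by simpa using hzτ, hz⟩
      rw [add_comm 1 (k + 1)] at this
      rw [ContinuousLinearMap.comp_assoc, hι]
      exact this)
  set α : ℝ := -(m : ℝ) - 1 + κ with hα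
  have hα0 : α ≤ 0 := by
    have := hκ.2
    have : (0 : ℝ) ≤ m := m.cast_nonneg
    linarith
  set D' := ‖TY‖ * (M * Real.exp ω * ‖TX‖)
  have hD' : 0 ≤ D' := by positivity
  refine ⟨(D + D' + 1) * 2 ^ (-α), by positivity, fun t ht => ?_⟩
  have hsq0 : 0 < Real.sqrt (1 + t ^ 2) := Real.sqrt_pos.2 (by positivity)
  -- With `2 max(t, 1) ≥ ⟨t⟩`, it is enough to bound by `max(t, 1) ^ α`.
  have hcmp : ∀ s : ℝ, 1 ≤ s → t ≤ s → s ^ α ≤ 2 ^ (-α) * Real.sqrt (1 + t ^ 2) ^ α := by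
    intro s hs hts
    have h1 : Real.sqrt (1 + t ^ 2) ≤ 2 * s := by
      rw [Real.sqrt_le_left (by linarith)]
      nlinarith
    have h2 := Real.rpow_le_rpow_of_nonpos hsq0 h1 hα0
    rw [Real.mul_rpow two_pos.le (by linarith)] at h2
    calc s ^ α = 2 ^ (-α) * (2 ^ α * s ^ α) := by
          rw [← mul_assoc, ← Real.rpow_add two_pos]; simp
      _ ≤ _ := by gcongr
  suffices h : ∃ s : ℝ, 1 ≤ s ∧ t ≤ s ∧ ‖TY ∘L S t ∘L TX‖ ≤ (D + D' + 1) * s ^ α by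
    obtain ⟨s, hs, hts, h⟩ := h
    rw [mul_assoc]
    exact h.trans (mul_le_mul_of_nonneg_left (hcmp s hs hts) (by positivity))
  rcases le_total t 1 with ht1 | ht1
  · refine ⟨1, le_rfl, ht1, ?_⟩
    rw [Real.one_rpow, mul_one]
    refine le_trans ?_ (show D' ≤ D + D' + 1 by linarith)
    refine (ContinuousLinearMap.opNorm_comp_le _ _).trans ?_
    refine mul_le_mul_of_nonneg_left ?_ (norm_nonneg _)
    refine (ContinuousLinearMap.opNorm_comp_le _ _).trans ?_
    refine mul_le_mul_of_nonneg_right ((hS t ht).trans ?_) (norm_nonneg _)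
    refine mul_le_mul_of_nonneg_left (Real.exp_le_exp.2 ?_) hM0
    exact mul_le_of_le_one_right hω ht1
  · refine ⟨t, ht1, le_rfl, ?_⟩
    have ht0 : 0 < t := by linarith
    have h := hD t ht1
    rw [ContinuousLinearMap.comp_assoc, hι] at h
    have hexp : t ^ (-((m : ℝ) - κ - ((k + 1 : ℕ) : ℝ)) - 1) = t ^ (k + 1) * t ^ α := by
      rw [← Real.rpow_natCast t (k + 1), ← Real.rpow_add ht0]
      congr 1
      rw [hα]
      ring
    rw [hexp, mul_left_comm] at h
    refine (le_of_mul_le_mul_left h (by positivity)).trans ?_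
    gcongr
    linarith
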